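/- Let $0<\rho<1$, $0\le \pi<1$, let $f_0,f_1$ be probability density functions on $\mathbb R$ with finite Kullback--Leibler divergence $D(f_1\|f_0)=\int f_1\log (f_1/f_0)<\infty$, let $p=(p_i)_{i\ge 0}$ be a probability mass function on $\{0,1,2,\dots\}$, and let $N,C\ge 0$ be integers. Model. The change-point $\Lambda$ satisfies $P(\Lambda=0)=\pi$ and $P(\Lambda=\lambda)=(1-\pi)\rho(1-\rho)^{\lambda-1}$ for $\lambda\ge 1$. Given $\Lambda=\lambda$, the signal $X_1,X_2,\dots$ is independent, $X_k$ having density $f_0$ for $k<\lambda$ and $f_1$ for $k\ge\lambda$. The numbers $\nu_1,\nu_2,\dots$ of sampling rights collected in the time slots are i.i.d. with probability mass function $p$ and independent of $(\Lambda,X_1,X_2,\dots)$. A sampling strategy is a sequence of decisions $\mu_k\in\{0,1\}$ of the form $\mu_k=g_k(Z_1,\dots,Z_{k-1},\nu_1,\dots,\nu_k,\mu_1,\dots,\mu_{k-1})$ with measurable $g_k$, where the observation $Z_k$ is $X_k$ if $\mu_k=1$ and a symbol $\phi$ ("no observation") if $\mu_k=0$. With $N_0=N$ and $N_k=\min\{C,\,N_{k-1}+\nu_k-\mu_k\}$,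 the strategy is admissible if almost surely $N_k\ge 0$ for all $k\ge 1$. Let $\mathcal F_k=\sigma(Z_1,\dots,Z_k)$; if $\pi=0$, one may also take $\mathcal F_k=\sigma(Z_1,\dots,Z_k,\{\Lambda=0\})$. For a stopping time $\tau$ of $(\mathcal F_k)_{k\ge 0}$ with values in $\{0,1,\dots,\infty\}$, put $\mathrm{ADD}(\tau,\mu)=\mathbb E[(\tau-\Lambda)^+]\in[0,\infty]$ and $\mathrm{PFA}(\tau,\mu)=P(\tau<\Lambda)$. The greedy strategy samples in slot $k$ exactly when $N_{k-1}+\nu_k\ge 1$; under it $(N_k)$ is a Markov chain. Let $\tilde w$ be a stationary distribution of this chain, and let $\tilde p=1-p_0\tilde w_0$ be the stationary probability that the greedy strategy samples. Theorem. As $\alpha\to 0$, $$\inf \mathrm{ADD}(\tau,\mu)\ \ge\ \frac{|\log\alpha|}{\tilde p\,D(f_1\|f_0)+|\log(1-\rho)|}\,(1+o(1)),$$ where the infimum is over all admissible strategies $\mu$ and all such stopping times $\tau$ with $\mathrm{PFA}(\tau,\mu)\le\alpha$. That is, there is a function $o(\alpha)\to 0$ as $\alpha\downarrow 0$, depending only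 on $\pi,\rho,f_0,f_1,p,N,C$ (and $\tilde w$), such that $\mathrm{ADD}(\tau,\mu)\ge \frac{|\log\alpha|}{\tilde p D(f_1\|f_0)+|\log(1-\rho)|}(1+o(\alpha))$ for every $\alpha\in(0,1)$ and every admissible $\mu$ and stopping time $\tau$ with $\mathrm{PFA}(\tau,\mu)\le\alpha$. -/

import Mathlib

open MeasureTheory ProbabilityTheory Filter Topology
open scoped ENNReal

namespace SamplingRights

noncomputable section

/-- A probability density function on the real line. -/
structure Pdf where
  toFun : ℝ → ℝ
  measurable : Measurable toFun
  nonneg : ∀ x, 0 ≤ toFun x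
  lintegral_eq_one : ∫⁻ x, ENNReal.ofReal (toFun x) = 1

/-- The law with density `f` with respect to Lebesgue measure. -/
def Pdf.law (f : Pdf) : Measure ℝ :=
  volume.withDensity fun x => ENNReal.ofReal (f.toFun x)

instance (f : Pdf) : IsProbabilityMeasure f.law :=
  ⟨by rw [Pdf.law, withDensity_apply _ MeasurableSet.univ, Measure.restrict_univ,
    f.lintegral_eq_one]⟩

/-- The sample space: a point is `(lam, x, v)`, where `lam` is the change-point, `x i` is the
value `X_{i+1}` of the signal and `v i` is the number `ν_{i+1}` of sampling rights collected,
both at time slot `i + 1`. All sequences over time slots `1, 2, …` are indexed in this way. -/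
abbrev Path := ℕ × (ℕ → ℝ) × (ℕ → ℕ)

/-- The change-point `Λ`. -/
def changePoint (ω : Path) : ℕ := ω.1

/-- The signal: `signal i` is `X_{i+1}`. -/
def signal (i : ℕ) (ω : Path) : ℝ := ω.2.1 i

/-- The replenishing process: `arrivals i` is `ν_{i+1}`. -/
def arrivals (i : ℕ) (ω : Path) : ℕ := ω.2.2 i

/-- The prior of the change-point: mass `prior` at `0`, and `(1 - prior) ρ (1 - ρ)^(l - 1)`
at `l ≥ 1`. -/
def changeWeight (prior ρ : ℝ) : ℕ → ℝ≥0∞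
  | 0 => ENNReal.ofReal prior
  | l + 1 => ENNReal.ofReal ((1 - prior) * ρ * (1 - ρ) ^ l)

/-- The joint law of the signal and the replenishing process given `Λ = l`: the `X_k` are
independent, with density `f₀` for `k < l` and `f₁` for `k ≥ l`; the `ν_k` are i.i.d. with
probability mass function `p`, independent of the signal. -/
def conditionalLaw (f₀ f₁ : Pdf) (p : PMF ℕ) (l : ℕ) : Measure ((ℕ → ℝ) × (ℕ → ℕ)) :=
  (Measure.infinitePi fun i : ℕ => (if i + 1 < l then f₀ else f₁).law).prod
    (Measure.infinitePi fun _ : ℕ => p.toMeasure)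

/-- The probability measure of the Bayesian model. -/
def modelLaw (prior ρ : ℝ) (f₀ f₁ : Pdf) (p : PMF ℕ) : Measure Path :=
  Measure.sum fun l => changeWeight prior ρ l •
    (Measure.dirac l).prod (conditionalLaw f₀ f₁ p l)

/-- Values of the observation sequence: `Sum.inl x` is the observation `x`, and `Sum.inr ()` is
the symbol for "no observation". -/
abbrev Obs := ℝ ⊕ Unit

/-- A causal sampling strategy: the decision at slot `k + 1` is a measurable function of the
observations in slots `1, …, k`, of the arrivals in slots `1, …, k + 1`, and of the sampling
decisions in slots `1, …, k`. The value `true` means that an observation is taken. -/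
structure Strategy where
  rule : (k : ℕ) → (Fin k → Obs) × (Fin (k + 1) → ℕ) × (Fin k → Bool) → Bool
  measurable_rule : ∀ k, Measurable (rule k)

namespace Strategy

/-- The observation resulting from a sampling decision. -/
def observe (b : Bool) (x : ℝ) : Obs := if b then Sum.inl x else Sum.inr ()

/-- The sampling decision `μ_{k+1}`. -/
def decision (g : Strategy) (k : ℕ) (ω : Path) : Bool :=
  g.rule k (fun i => observe (g.decision i ω) (signal i ω), fun i => arrivals i ω,
    fun i => g.decision i ω)
termination_by k
decreasing_by all_goals exact i.isLt

/-- The observation `Z_{k+1}`. -/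
def obs (g : Strategy) (k : ℕ) (ω : Path) : Obs := observe (g.decision k ω) (signal k ω)

lemma measurable_observe : Measurable fun q : Bool × ℝ => observe q.1 q.2 := by
  refine Measurable.ite (measurable_fst (measurableSet_singleton true)) ?_ measurable_const
  exact measurable_inl.comp measurable_snd

lemma measurable_signal (i : ℕ) : Measurable (signal i) := by
  unfold signal; fun_prop

lemma measurable_arrivals (i : ℕ) : Measurable (arrivals i) := by
  unfold arrivals; fun_prop

lemma measurable_decision (g : Strategy) (k : ℕ) : Measurable (g.decision k) := by
  induction k using Nat.strong_induction_on with
  | _ k ih =>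
    have h : g.decision k = fun ω => g.rule k
        (fun i => observe (g.decision i ω) (signal i ω), fun i => arrivals i ω,
          fun i => g.decision i ω) := by
      funext ω; rw [decision]
    rw [h]
    refine (g.measurable_rule k).comp (Measurable.prodMk ?_ (Measurable.prodMk ?_ ?_))
    · exact measurable_pi_lambda _ fun i =>
        measurable_observe.comp ((ih i i.isLt).prodMk (measurable_signal i))
    · exact measurable_pi_lambda _ fun i => measurable_arrivals i
    · exact measurable_pi_lambda _ fun i => ih i i.isLt

lemma measurable_obs (g : Strategy) (k : ℕ) : Measurable (g.obs k) :=
  measurable_observe.comp ((g.measurable_decision k).prodMk (measurable_signal k))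

/-- The filtration generated by the observations: its `k`-th member is `σ(Z_1, …, Z_k)`. -/
def obsFiltration (g : Strategy) : Filtration ℕ (inferInstance : MeasurableSpace Path) where
  seq k := ⨆ i : Fin k, MeasurableSpace.comap (g.obs i) inferInstance
  mono' _ _ hjk := iSup_le fun i =>
    le_iSup_of_le (Fin.castLE hjk i) le_rfl
  le' _ := iSup_le fun i => (g.measurable_obs i).comap_le

/-- The filtration whose `k`-th member is `σ(Z_1, …, Z_k, {Λ = 0})`. -/
def obsFiltrationWithZero (g : Strategy) :
    Filtration ℕ (inferInstance : MeasurableSpace Path) where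
  seq k := g.obsFiltration k ⊔ MeasurableSpace.generateFrom {{ω | changePoint ω = 0}}
  mono' _ _ hjk := sup_le_sup_right (g.obsFiltration.mono hjk) _
  le' k := sup_le (g.obsFiltration.le k) <| MeasurableSpace.generateFrom_le <| by
    rintro _ rfl
    exact measurable_fst (measurableSet_singleton 0)

/-- The number `N_k` of sampling rights at the end of slot `k`, starting with `N` rights and
with capacity `C`. It is an integer, which a strategy that is not admissible makes negative. -/
def rights (g : Strategy) (N C : ℕ) (ω : Path) : ℕ → ℤ
  | 0 => N
  | k + 1 => min (C : ℤ)
      (g.rights N C ω k + arrivals k ω - (if g.decision k ω then 1 else 0))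

/-- The strategy never spends a sampling right that it does not have. -/
def Admissible (g : Strategy) (N C : ℕ) (P : Measure Path) : Prop :=
  ∀ᵐ ω ∂P, ∀ k, 0 ≤ g.rights N C ω k

end Strategy

/-- The average detection delay `E[(τ - Λ)⁺]`; the subtraction of `ℕ∞` truncates at `0`. -/
def avgDelay (P : Measure Path) (τ : Path → ℕ∞) : ℝ≥0∞ :=
  ∫⁻ ω, ((τ ω - (changePoint ω : ℕ∞) : ℕ∞) : ℝ≥0∞) ∂P

/-- The probability of false alarm `P(τ < Λ)`. -/
def falseAlarm (P : Measure Path) (τ : Path → ℕ∞) : ℝ≥0∞ :=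
  P {ω | τ ω < (changePoint ω : ℕ∞)}

/-- The greedy strategy samples whenever a sampling right is available: its decision with `n`
rights left from the previous slot and `v` newly collected rights. -/
def greedyDecision (n v : ℕ) : Bool := decide (1 ≤ n + v)

/-- The number of sampling rights at the end of a slot under the greedy strategy. -/
def greedyStep (C n v : ℕ) : ℕ :=
  min C (n + v - (if greedyDecision n v then 1 else 0))

/-- `w` is a stationary distribution of the Markov chain of sampling rights under the greedy
strategy. -/
def IsGreedyStationary (C : ℕ) (p w : PMF ℕ) : Prop :=
  (w.bind fun n => p.map (greedyStep C n)) = w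

/-- The probability that the greedy strategy samples in a slot, when the number of sampling
rights left from the previous slot has distribution `w`. -/
def greedySamplingProb (p w : PMF ℕ) : ℝ :=
  ((w.bind fun n => p.map (greedyDecision n)) true).toReal

lemma greedySamplingProb_eq (p w : PMF ℕ) :
    greedySamplingProb p w = 1 - (p 0).toReal * (w 0).toReal := by
  have hf : (w.bind fun n => p.map (greedyDecision n)) false = w 0 * p 0 := by
    rw [PMF.bind_apply, tsum_eq_single 0]
    · rw [PMF.map_apply, tsum_eq_single 0]
      · simp [greedyDecision]
      · intro v hv
        simp [greedyDecision, hv]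
    · intro n hn
      have : (p.map (greedyDecision n)) false = 0 := by
        rw [PMF.map_apply]
        simp [greedyDecision, hn]
      rw [this, mul_zero]
  have hsum := (w.bind fun n => p.map (greedyDecision n)).tsum_coe
  rw [tsum_bool, hf] at hsum
  have h := congrArg ENNReal.toReal hsum
  rw [ENNReal.toReal_add (ENNReal.mul_ne_top (w.apply_ne_top 0) (p.apply_ne_top 0))
    (PMF.apply_ne_top _ _), ENNReal.toReal_mul, ENNReal.toReal_one] at h
  unfold greedySamplingProb
  linarith

end

end SamplingRights

/-! Stopping within `n` slots of a change at `j + 1` means stopping by slot `j + n`, and this would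
be a false alarm if the change came only at `j + n + 1`. The prior weight of that later change is a
constant times `(1 - ρ) ^ n`, so the false-alarm constraint bounds the probability of stopping by `j
+ n` under the later change by a constant times `α (1 - ρ) ^ (-n)`. The two laws differ only in
slots `j + 1, …, j + n`, and the detector sees only the sampled ones, so transferring the bound to
the earlier change costs the exponential of the log-likelihood ratio summed over sampled slots
(`conditionalLaw_le_exp_mul_add`). If that sum is at most about `p̃ D n`, early stopping has
probability of order `exp (n d - |log α|)` with `d = p̃ D + |log (1 - ρ)|`. This vanishes when `n`
is a fixed fraction, less than one, of `|log α| / d`, so the delay is then at least `n` with high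
probability.

The sum must be controlled uniformly over all admissible strategies, although decisions depend on
the data (`exists_measure_llr_le`). Pathwise, an admissible strategy takes at most `max N C` more
samples on a block of slots than the greedy one restarted there with no rights
(`count_le_greedyCount`). The restarted counts on disjoint blocks are independent, and their means
are at most the stationary ones, so Chebyshev's inequality bounds the sampling rate by `p̃ + δ`.
Since each decision precedes the value it may reveal, exponential moments factor slot by slot, which
gives Hoeffding's inequality for a truncated log-likelihood ratio. Markov's inequality handles the
truncation error.

Finally, the delay bound is summed over finitely many change-points carrying almost all the prior
mass (`eventually_le_avgDelay`). The thresholds do not depend on the strategy, so one `o` serves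
them all. -/

namespace SamplingRights

/-! ### Resampling one coordinate of a product measure -/

section Resampling

variable {ι S T : Type*} [MeasurableSpace S] [MeasurableSpace T]

/-- Replacing one coordinate of a product measure by an independent draw. -/
lemma map_update_infinitePi [DecidableEq ι] (μ μ' : ι → Measure S)
    [∀ i, IsProbabilityMeasure (μ i)] [∀ i, IsProbabilityMeasure (μ' i)] (j : ι)
    (h : ∀ i, i ≠ j → μ i = μ' i) :
    ((Measure.infinitePi μ).prod (μ' j)).map (fun q => Function.update q.1 j q.2)
      = Measure.infinitePi μ' := by
  have hm : Measurable fun q : (ι → S) × S => Function.update q.1 j q.2 := by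
    refine measurable_pi_lambda _ fun i => ?_
    by_cases hi : i = j
    · subst hi; simpa using measurable_snd
    · simp only [Function.update_of_ne hi]; fun_prop
  refine Measure.eq_infinitePi μ' fun s t ht => ?_
  have hpi : MeasurableSet (Set.pi (s : Set ι) t) :=
    MeasurableSet.pi s.countable_toSet fun i _ => ht i
  rw [Measure.map_apply hm hpi]
  by_cases hj : j ∈ s
  · have hset : (fun q : (ι → S) × S => Function.update q.1 j q.2) ⁻¹' Set.pi (s : Set ι) t
        = Set.pi ((s.erase j : Finset ι) : Set ι) t ×ˢ t j := by
      ext ⟨x, y⟩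
      simp only [Set.mem_preimage, Set.mem_pi, Set.mem_prod, Finset.mem_coe, Finset.mem_erase]
      constructor
      · intro H
        refine ⟨fun i hi => ?_, ?_⟩
        · simpa [Function.update_of_ne hi.1] using H i hi.2
        · simpa using H j hj
      · rintro ⟨H, hy⟩ i hi
        by_cases hij : i = j
        · subst hij; simpa using hy
        · simpa [Function.update_of_ne hij] using H i ⟨hij, hi⟩
    rw [hset, Measure.prod_prod, Measure.infinitePi_pi μ (fun i _ => ht i),
      ← Finset.prod_erase_mul s _ hj]
    congr 1
    exact Finset.prod_congr rfl fun i hi => by rw [h i (Finset.ne_of_mem_erase hi)]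
  · have hset : (fun q : (ι → S) × S => Function.update q.1 j q.2) ⁻¹' Set.pi (s : Set ι) t
        = Set.pi (s : Set ι) t ×ˢ Set.univ := by
      ext ⟨x, y⟩
      simp only [Set.mem_preimage, Set.mem_pi, Set.mem_prod, Finset.mem_coe, Set.mem_univ,
        and_true]
      refine forall₂_congr fun i hi => ?_
      have hij : i ≠ j := by rintro rfl; exact hj hi
      rw [Function.update_of_ne hij]
    rw [hset, Measure.prod_prod, Measure.infinitePi_pi μ (fun i _ => ht i), measure_univ, mul_one]
    exact Finset.prod_congr rfl fun i hi => by rw [h i (fun hij => hj (hij ▸ hi))]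

lemma measurable_update_prod [DecidableEq ι] (j : ι) :
    Measurable fun q : ((ι → S) × T) × S => (Function.update q.1.1 j q.2, q.1.2) := by
  refine Measurable.prodMk (measurable_pi_lambda _ fun i => ?_) (by fun_prop)
  by_cases hi : i = j
  · subst hi; simpa using measurable_snd
  · simp only [Function.update_of_ne hi]; fun_prop

lemma lintegral_infinitePi_update [DecidableEq ι] (μ μ' : ι → Measure S)
    [∀ i, IsProbabilityMeasure (μ i)] [∀ i, IsProbabilityMeasure (μ' i)] (j : ι)
    (h : ∀ i, i ≠ j → μ i = μ' i) {Φ : (ι → S) → ℝ≥0∞} (hΦ : Measurable Φ) :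
    ∫⁻ x, Φ x ∂Measure.infinitePi μ'
      = ∫⁻ x, ∫⁻ y, Φ (Function.update x j y) ∂μ' j ∂Measure.infinitePi μ := by
  have hm : Measurable fun q : (ι → S) × S => Function.update q.1 j q.2 := by
    have := (measurable_update_prod (S := S) (T := Unit) j).fst.comp
      (Measurable.prodMk (Measurable.prodMk (measurable_fst (α := ι → S) (β := S))
        (measurable_const (a := ()))) measurable_snd)
    exact this
  rw [← map_update_infinitePi μ μ' j h, lintegral_map hΦ hm,
    lintegral_prod (fun q : (ι → S) × S => Φ (Function.update q.1 j q.2))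
      (hΦ.comp hm).aemeasurable]

lemma lintegral_infinitePi_prod_update [DecidableEq ι] (μ μ' : ι → Measure S)
    [∀ i, IsProbabilityMeasure (μ i)] [∀ i, IsProbabilityMeasure (μ' i)] (j : ι)
    (h : ∀ i, i ≠ j → μ i = μ' i) (κ : Measure T) [IsProbabilityMeasure κ]
    {Φ : (ι → S) × T → ℝ≥0∞} (hΦ : Measurable Φ) :
    ∫⁻ z, Φ z ∂(Measure.infinitePi μ').prod κ
      = ∫⁻ z, ∫⁻ y, Φ (Function.update z.1 j y, z.2) ∂μ' j ∂(Measure.infinitePi μ).prod κ := by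
  have hm : Measurable fun z : (ι → S) × T => ∫⁻ y, Φ (Function.update z.1 j y, z.2) ∂μ' j :=
    (hΦ.comp (measurable_update_prod j)).lintegral_prod_right'
  rw [lintegral_prod_symm _ hΦ.aemeasurable, lintegral_prod_symm _ hm.aemeasurable]
  refine lintegral_congr fun v => ?_
  exact lintegral_infinitePi_update μ μ' j h (hΦ.comp (measurable_id.prodMk measurable_const))

end Resampling

/-! ### Causality of decisions and observations -/

section Paths

variable (g : Strategy)

lemma Strategy.decision_eq (k : ℕ) (ω : Path) :
    g.decision k ω = g.rule k (fun i => g.obs i ω, fun i => arrivals i ω,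
      fun i => g.decision i ω) := by
  rw [Strategy.decision]; rfl

/-- Decisions depend on the path through the arrivals and the signal in the sampled slots. -/
lemma Strategy.decision_congr {ω ω' : Path} (k : ℕ)
    (hv : ∀ i, arrivals i ω = arrivals i ω')
    (hx : ∀ i < k, g.decision i ω = true → signal i ω = signal i ω') :
    g.decision k ω = g.decision k ω' := by
  induction k using Nat.strong_induction_on with
  | _ k ih =>
    have hd : ∀ i < k, g.decision i ω = g.decision i ω' := fun i hi =>
      ih i hi fun j hj => hx j (hj.trans hi)
    have ho : ∀ i < k, g.obs i ω = g.obs i ω' := by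
      intro i hi
      unfold Strategy.obs Strategy.observe
      rw [← hd i hi]
      split_ifs with hb
      · rw [hx i hi hb]
      · rfl
    rw [g.decision_eq k ω, g.decision_eq k ω']
    congr 1
    refine Prod.ext (funext fun i => ho i i.isLt) (Prod.ext (funext fun i => hv i)
      (funext fun i => hd i i.isLt))

lemma Strategy.obs_congr {ω ω' : Path} (k : ℕ)
    (hv : ∀ i, arrivals i ω = arrivals i ω')
    (hx : ∀ i < k + 1, g.decision i ω = true → signal i ω = signal i ω') :
    g.obs k ω = g.obs k ω' := by
  have hd := g.decision_congr k hv fun i hi => hx i (Nat.lt_succ_of_lt hi)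
  unfold Strategy.obs Strategy.observe
  rw [← hd]
  split_ifs with hb
  · rw [hx k (Nat.lt_succ_self k) hb]
  · rfl

/-- The sampling decision as a function of the signal and the arrivals. -/
def Strategy.sampled (k : ℕ) (z : (ℕ → ℝ) × (ℕ → ℕ)) : Bool := g.decision k (1, z)

lemma Strategy.decision_eq_sampled (k l : ℕ) (z : (ℕ → ℝ) × (ℕ → ℕ)) :
    g.decision k (l, z) = g.sampled k z :=
  g.decision_congr k (fun _ => rfl) fun _ _ _ => rfl

lemma Strategy.obs_eq_obs_one (k l : ℕ) (z : (ℕ → ℝ) × (ℕ → ℕ)) :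
    g.obs k (l, z) = g.obs k (1, z) :=
  g.obs_congr k (fun _ => rfl) fun _ _ _ => rfl

lemma Strategy.measurable_sampled (k : ℕ) : Measurable (g.sampled k) :=
  (g.measurable_decision k).comp (measurable_const.prodMk measurable_id)

lemma Strategy.sampled_update {j k : ℕ} (h : k ≤ j) (z : (ℕ → ℝ) × (ℕ → ℕ)) (y : ℝ) :
    g.sampled k (Function.update z.1 j y, z.2) = g.sampled k z := by
  refine g.decision_congr k (fun _ => rfl) fun i hi _ => ?_
  simp [signal, Function.update_of_ne (show i ≠ j by lia)]

lemma signal_update_of_sampled_eq_false {j : ℕ} {z : (ℕ → ℝ) × (ℕ → ℕ)}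
    (h : g.sampled j z = false) (y : ℝ) (i : ℕ) (hi : g.decision i (1, z) = true) :
    signal i (1, z) = signal i (1, Function.update z.1 j y, z.2) := by
  have : i ≠ j := by rintro rfl; simp [Strategy.sampled, hi] at h
  simp [signal, Function.update_of_ne this]

/-- An unsampled value is never read, so it influences no decision, not even after slot `j`. -/
lemma Strategy.sampled_update_of_eq_false {j : ℕ} {z : (ℕ → ℝ) × (ℕ → ℕ)}
    (h : g.sampled j z = false) (y : ℝ) (k : ℕ) :
    g.sampled k (Function.update z.1 j y, z.2) = g.sampled k z :=
  (g.decision_congr (ω := (1, z)) (ω' := (1, Function.update z.1 j y, z.2)) k (fun _ => rfl) fun i _ hi =>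
    signal_update_of_sampled_eq_false g h y i hi).symm

lemma Strategy.obs_update_of_eq_false {j : ℕ} {z : (ℕ → ℝ) × (ℕ → ℕ)}
    (h : g.sampled j z = false) (y : ℝ) (k : ℕ) :
    g.obs k (1, Function.update z.1 j y, z.2) = g.obs k (1, z) :=
  (g.obs_congr (ω := (1, z)) (ω' := (1, Function.update z.1 j y, z.2)) k (fun _ => rfl) fun i _ hi =>
    signal_update_of_sampled_eq_false g h y i hi).symm

end Paths

/-! ### Change of measure and exponential moments along the sampled slots -/

section ChangeOfMeasure

/-- The law of `X_{i+1}` given that the change occurs at `l`. -/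
noncomputable def siteLaw (f₀ f₁ : Pdf) (l i : ℕ) : Measure ℝ := (if i + 1 < l then f₀ else f₁).law

instance (f₀ f₁ : Pdf) (l i : ℕ) : IsProbabilityMeasure (siteLaw f₀ f₁ l i) := by
  unfold siteLaw; infer_instance

lemma conditionalLaw_eq (f₀ f₁ : Pdf) (p : PMF ℕ) (l : ℕ) :
    conditionalLaw f₀ f₁ p l = (Measure.infinitePi (siteLaw f₀ f₁ l)).prod
      (Measure.infinitePi fun _ : ℕ => p.toMeasure) := rfl

instance (f₀ f₁ : Pdf) (p : PMF ℕ) (l : ℕ) : IsProbabilityMeasure (conditionalLaw f₀ f₁ p l) := by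
  rw [conditionalLaw_eq]; infer_instance

lemma conditionalLaw_zero (f₀ f₁ : Pdf) (p : PMF ℕ) :
    conditionalLaw f₀ f₁ p 0 = conditionalLaw f₀ f₁ p 1 := by
  have : siteLaw f₀ f₁ 0 = siteLaw f₀ f₁ 1 := by
    funext i; simp [siteLaw]
  rw [conditionalLaw_eq, conditionalLaw_eq, this]

/-- The factor cancels the density of `μ` where it is positive. Equality can fail because `ν` may
charge the set where the density vanishes. -/
lemma lintegral_exp_neg_llr_mul_le {S : Type*} [MeasurableSpace S] (μ ν : Measure S)
    [IsProbabilityMeasure μ] [IsProbabilityMeasure ν] (hac : μ ≪ ν) {φ : S → ℝ≥0∞}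
    (hφ : Measurable φ) :
    ∫⁻ y, ENNReal.ofReal (Real.exp (-llr μ ν y)) * φ y ∂μ ≤ ∫⁻ y, φ y ∂ν := by
  have hm : Measurable fun y => ENNReal.ofReal (Real.exp (-llr μ ν y)) * φ y := by
    have := measurable_llr μ ν
    fun_prop
  calc ∫⁻ y, ENNReal.ofReal (Real.exp (-llr μ ν y)) * φ y ∂μ
      = ∫⁻ y, μ.rnDeriv ν y * (ENNReal.ofReal (Real.exp (-llr μ ν y)) * φ y) ∂ν := by
        rw [lintegral_rnDeriv_mul hac hm.aemeasurable]
    _ ≤ ∫⁻ y, φ y ∂ν := by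
        refine lintegral_mono_ae ?_
        filter_upwards [Measure.rnDeriv_lt_top μ ν] with y hy
        rcases eq_or_ne (μ.rnDeriv ν y) 0 with h0 | h0
        · simp [h0]
        · have hpos : 0 < (μ.rnDeriv ν y).toReal := ENNReal.toReal_pos h0 hy.ne
          have : μ.rnDeriv ν y * ENNReal.ofReal (Real.exp (-llr μ ν y)) = 1 := by
            rw [llr, Real.exp_neg, Real.exp_log hpos, ENNReal.ofReal_inv_of_pos hpos,
              ENNReal.ofReal_toReal hy.ne, ENNReal.mul_inv_cancel h0 hy.ne]
          rw [← mul_assoc, this, one_mul]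

variable (f₀ f₁ : Pdf) (p : PMF ℕ) (g : Strategy)

/-- The product over the slots `j + 1, …, j + n` in which the strategy samples of `F` of the
observed value. -/
noncomputable def sampledProd (F : ℝ → ℝ≥0∞) (j n : ℕ) (z : (ℕ → ℝ) × (ℕ → ℕ)) : ℝ≥0∞ :=
  ∏ i ∈ Finset.range n, if g.sampled (j + i) z then F (z.1 (j + i)) else 1

lemma measurable_sampledProd {F : ℝ → ℝ≥0∞} (hF : Measurable F) (j n : ℕ) :
    Measurable (sampledProd g F j n) := by
  refine Finset.measurable_prod _ fun i _ => ?_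
  refine Measurable.ite ?_ (by fun_prop) measurable_const
  exact (g.measurable_sampled (j + i)) (measurableSet_singleton true)

/-- An event that is determined by the observations. -/
def ObsInvariant (A : Set ((ℕ → ℝ) × (ℕ → ℕ))) (T : ℕ) : Prop :=
  ∀ z z' : (ℕ → ℝ) × (ℕ → ℕ), (∀ k < T, g.obs k (1, z) = g.obs k (1, z')) → (z ∈ A ↔ z' ∈ A)

/-- Change of measure along the sampled observations. -/
lemma lintegral_sampledProd_indicator_le (hac : f₁.law ≪ f₀.law)
    {A : Set ((ℕ → ℝ) × (ℕ → ℕ))} (hA : MeasurableSet A) {T : ℕ} (hAT : ObsInvariant g A T)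
    (n j : ℕ) :
    ∫⁻ z, sampledProd g (fun y => ENNReal.ofReal (Real.exp (-llr f₁.law f₀.law y))) j n z
        * A.indicator 1 z ∂conditionalLaw f₀ f₁ p (j + 1)
      ≤ conditionalLaw f₀ f₁ p (j + n + 1) A := by
  set R : ℝ → ℝ≥0∞ := fun y => ENNReal.ofReal (Real.exp (-llr f₁.law f₀.law y)) with hR
  have hRm : Measurable R := by
    have := measurable_llr f₁.law f₀.law
    fun_prop
  have h1A : Measurable (A.indicator (1 : (ℕ → ℝ) × (ℕ → ℕ) → ℝ≥0∞)) :=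
    measurable_one.indicator hA
  induction n generalizing j with
  | zero => simp [sampledProd, lintegral_indicator_one hA]
  | succ n ih =>
    set W : (ℕ → ℝ) × (ℕ → ℕ) → ℝ≥0∞ := fun z => sampledProd g R (j + 1) n z * A.indicator 1 z
      with hW
    have hWm : Measurable W := (measurable_sampledProd g hRm _ _).mul h1A
    have hsplit : ∀ z, sampledProd g R j (n + 1) z * A.indicator 1 z
        = (if g.sampled j z then R (z.1 j) else 1) * W z := by
      intro z
      simp only [hW, sampledProd, Finset.prod_range_succ', add_zero]
      rw [← mul_assoc]
      congr 1
      rw [mul_comm]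
      congr 1
      refine Finset.prod_congr rfl fun i _ => ?_
      rw [show j + (i + 1) = j + 1 + i by ring]
    have hfm : Measurable fun z : (ℕ → ℝ) × (ℕ → ℕ) =>
        (if g.sampled j z then R (z.1 j) else 1) * W z := by
      refine Measurable.mul (Measurable.ite ?_ (by fun_prop) measurable_const) hWm
      exact (g.measurable_sampled j) (measurableSet_singleton true)
    have hsite : ∀ i, i ≠ j → siteLaw f₀ f₁ (j + 2) i = siteLaw f₀ f₁ (j + 1) i := by
      intro i hi
      unfold siteLaw
      congr 2
      exact propext ⟨fun h => by lia, fun h => by lia⟩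
    have h1 : siteLaw f₀ f₁ (j + 1) j = f₁.law := by simp [siteLaw]
    have h0 : siteLaw f₀ f₁ (j + 2) j = f₀.law := by simp [siteLaw]
    -- The laws for changes at `j + 1` and `j + 2` differ only in coordinate `j`. That coordinate is
    -- drawn afresh from `f₁`, exchanged for a draw from `f₀` at the cost of the factor `R`, and
    -- absorbed back; this moves the change one slot later.
    calc ∫⁻ z, sampledProd g R j (n + 1) z * A.indicator 1 z ∂conditionalLaw f₀ f₁ p (j + 1)
        = ∫⁻ z, (if g.sampled j z then R (z.1 j) else 1) * W z
            ∂conditionalLaw f₀ f₁ p (j + 1) := lintegral_congr hsplit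
      _ = ∫⁻ z, ∫⁻ y, (if g.sampled j z then R y else 1) * W (Function.update z.1 j y, z.2)
            ∂f₁.law ∂conditionalLaw f₀ f₁ p (j + 2) := by
          rw [conditionalLaw_eq, lintegral_infinitePi_prod_update _ _ j hsite _ hfm,
            ← conditionalLaw_eq, h1]
          simp only [g.sampled_update le_rfl, Function.update_self]
      _ ≤ ∫⁻ z, ∫⁻ y, W (Function.update z.1 j y, z.2)
            ∂f₀.law ∂conditionalLaw f₀ f₁ p (j + 2) := by
          refine lintegral_mono fun z => ?_
          have hWu : Measurable fun y => W (Function.update z.1 j y, z.2) :=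
            (hWm.comp (measurable_update_prod j)).comp (measurable_const.prodMk measurable_id)
          cases hb : g.sampled j z with
          | true => simpa using lintegral_exp_neg_llr_mul_le f₁.law f₀.law hac hWu
          | false =>
            -- Without a sample in this slot, neither the later factors nor the event `A` sees the
            -- coordinate, so its law is irrelevant.
            have hc : ∀ y, W (Function.update z.1 j y, z.2) = W z := by
              intro y
              simp only [hW]
              congr 1
              · refine Finset.prod_congr rfl fun i _ => ?_
                rw [g.sampled_update_of_eq_false hb]
                simp only [Function.update_of_ne (show j + 1 + i ≠ j by lia)]
              · have := hAT (Function.update z.1 j y, z.2) z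
                  fun k _ => g.obs_update_of_eq_false hb y k
                by_cases hz : z ∈ A
                · rw [Set.indicator_of_mem hz, Set.indicator_of_mem (this.2 hz)]; rfl
                · rw [Set.indicator_of_notMem hz, Set.indicator_of_notMem (fun h => hz (this.1 h))]
            simp [hc]
      _ = ∫⁻ z, W z ∂conditionalLaw f₀ f₁ p (j + 2) := by
          rw [conditionalLaw_eq, lintegral_infinitePi_prod_update _ _ j (fun _ _ => rfl) _ hWm, h0]
      _ ≤ conditionalLaw f₀ f₁ p (j + (n + 1) + 1) A := by
          have := ih (j + 1)
          rwa [show j + 1 + n + 1 = j + (n + 1) + 1 by ring] at this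

/-- Exponential moments of sums over predictably sampled slots. -/
lemma lintegral_sampledProd_le {F : ℝ → ℝ≥0∞} (hF : Measurable F) {c : ℝ≥0∞} (hc : 1 ≤ c)
    (hFc : ∫⁻ y, F y ∂f₁.law ≤ c) (j n : ℕ) :
    ∫⁻ z, sampledProd g F j n z ∂conditionalLaw f₀ f₁ p (j + 1) ≤ c ^ n := by
  induction n with
  | zero => simp [sampledProd]
  | succ n ih =>
    have hsite : siteLaw f₀ f₁ (j + 1) (j + n) = f₁.law := by simp [siteLaw]
    have hsplit : ∀ z, sampledProd g F j (n + 1) z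
        = sampledProd g F j n z * if g.sampled (j + n) z then F (z.1 (j + n)) else 1 := fun z =>
      Finset.prod_range_succ _ _
    rw [conditionalLaw_eq, lintegral_infinitePi_prod_update _ _ (j + n) (fun _ _ => rfl) _
      (measurable_sampledProd g hF _ _), ← conditionalLaw_eq, hsite]
    calc _ ≤ ∫⁻ z, sampledProd g F j n z * c ∂conditionalLaw f₀ f₁ p (j + 1) := by
          refine lintegral_mono fun z => ?_
          -- The first `n` factors, like the decision in the last slot, are fixed before the value
          -- at `j + n` is drawn. The bound `1 ≤ c` covers the case where that slot is not sampled.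
          have hpre : ∀ y, sampledProd g F j n (Function.update z.1 (j + n) y, z.2)
              = sampledProd g F j n z := fun y => by
            refine Finset.prod_congr rfl fun i hi => ?_
            have := Finset.mem_range.1 hi
            rw [g.sampled_update (by lia)]
            simp only [Function.update_of_ne (show j + i ≠ j + n by lia)]
          simp only [hsplit, hpre, g.sampled_update le_rfl, Function.update_self]
          cases g.sampled (j + n) z with
          | true =>
            simp only [if_true]
            rw [lintegral_const_mul _ hF]
            gcongr
          | false => simpa using le_mul_of_one_le_right' hc
      _ ≤ c ^ (n + 1) := by
          rw [lintegral_mul_const _ (measurable_sampledProd g hF _ _), pow_succ]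
          gcongr

end ChangeOfMeasure

/-! ### The greedy chain and its stationary sampling rate -/

section Greedy

/-- The number of sampling rights held after `k` slots by the greedy strategy that starts with
`n` rights after slot `s`, when the arrivals are `v`. -/
def greedyState (C s n : ℕ) (v : ℕ → ℕ) : ℕ → ℕ
  | 0 => n
  | k + 1 => greedyStep C (greedyState C s n v k) (v (s + k))

/-- The number of observations taken in `k` slots by the greedy strategy that starts with
`n` rights after slot `s`, when the arrivals are `v`. -/
def greedyCount (C s n : ℕ) (v : ℕ → ℕ) (k : ℕ) : ℕ :=
  ∑ i ∈ Finset.range k, if greedyDecision (greedyState C s n v i) (v (s + i)) then 1 else 0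

lemma greedyStep_mono {C n n' : ℕ} (h : n ≤ n') (v : ℕ) : greedyStep C n v ≤ greedyStep C n' v := by
  unfold greedyStep greedyDecision
  simp only [decide_eq_true_eq]
  refine min_le_min le_rfl ?_
  split_ifs <;> lia

lemma greedyState_mono {n n' : ℕ} (C s : ℕ) (h : n ≤ n') (v : ℕ → ℕ) (k : ℕ) :
    greedyState C s n v k ≤ greedyState C s n' v k := by
  induction k with
  | zero => exact h
  | succ k ih => exact greedyStep_mono ih _

lemma greedyCount_mono {n n' : ℕ} (C s : ℕ) (h : n ≤ n') (v : ℕ → ℕ) (k : ℕ) :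
    greedyCount C s n v k ≤ greedyCount C s n' v k := by
  refine Finset.sum_le_sum fun i _ => ?_
  have := greedyState_mono C s h v i
  simp only [greedyDecision, decide_eq_true_eq]
  split_ifs <;> lia

lemma greedyCount_le (C s n : ℕ) (v : ℕ → ℕ) (k : ℕ) : greedyCount C s n v k ≤ k := by
  refine (Finset.sum_le_card_nsmul _ _ 1 fun i _ => ?_).trans (by simp)
  split_ifs <;> simp

lemma greedyState_congr (C s n : ℕ) {v v' : ℕ → ℕ} (k : ℕ)
    (h : ∀ i < k, v (s + i) = v' (s + i)) : greedyState C s n v k = greedyState C s n v' k := by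
  induction k with
  | zero => rfl
  | succ k ih =>
    simp only [greedyState]
    rw [ih fun i hi => h i (Nat.lt_succ_of_lt hi), h k (Nat.lt_succ_self k)]

lemma greedyCount_congr (C s n : ℕ) {v v' : ℕ → ℕ} (k : ℕ)
    (h : ∀ i < k, v (s + i) = v' (s + i)) : greedyCount C s n v k = greedyCount C s n v' k := by
  refine Finset.sum_congr rfl fun i hi => ?_
  have hik := Finset.mem_range.1 hi
  rw [greedyState_congr C s n i fun j hj => h j (hj.trans hik), h i hik]

lemma measurable_greedyState (C s n k : ℕ) : Measurable fun v => greedyState C s n v k := by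
  induction k with
  | zero => exact measurable_const
  | succ k ih =>
    exact (measurable_from_prod_countable_right (f := fun q : ℕ × ℕ => greedyStep C q.1 q.2)
      fun _ => measurable_from_top).comp (ih.prodMk (measurable_pi_apply (s + k)))

lemma measurable_greedyCount (C s n k : ℕ) : Measurable fun v => greedyCount C s n v k := by
  refine Finset.measurable_sum _ fun i _ => ?_
  exact (measurable_from_prod_countable_right
    (f := fun q : ℕ × ℕ => if greedyDecision q.1 q.2 then 1 else 0)
      fun _ => measurable_from_top).comp
    ((measurable_greedyState C s n i).prodMk (measurable_pi_apply (s + i)))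

variable (p : PMF ℕ)

lemma lintegral_pmf (f : ℕ → ℝ≥0∞) : ∫⁻ y, f y ∂p.toMeasure = ∑' y, p y * f y := by
  rw [lintegral_countable']
  refine tsum_congr fun y => ?_
  rw [PMF.toMeasure_apply_singleton _ _ (measurableSet_singleton y), mul_comm]

/-- The state reads only arrivals before index `s + k`, so the next arrival can be drawn
independently of it. -/
lemma lintegral_greedyState_arrival (C s n k : ℕ) (f : ℕ → ℕ → ℝ≥0∞) :
    ∫⁻ v, f (greedyState C s n v k) (v (s + k)) ∂Measure.infinitePi (fun _ : ℕ => p.toMeasure)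
      = ∫⁻ v, ∑' y, p y * f (greedyState C s n v k) y
          ∂Measure.infinitePi (fun _ : ℕ => p.toMeasure) := by
  have hm : Measurable fun v : ℕ → ℕ => f (greedyState C s n v k) (v (s + k)) :=
    (measurable_from_prod_countable_right (f := fun q : ℕ × ℕ => f q.1 q.2)
      fun _ => measurable_from_top).comp
        ((measurable_greedyState C s n k).prodMk (measurable_pi_apply (s + k)))
  rw [lintegral_infinitePi_update (fun _ : ℕ => p.toMeasure) _ (s + k) (fun _ _ => rfl) hm]
  refine lintegral_congr fun v => ?_
  rw [← lintegral_pmf]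
  refine lintegral_congr fun y => ?_
  rw [Function.update_self, greedyState_congr C s n (v' := v) k fun i hi => ?_]
  rw [Function.update_of_ne (by lia)]

lemma IsGreedyStationary.tsum_eq {C : ℕ} {p w : PMF ℕ} (hw : IsGreedyStationary C p w)
    (f : ℕ → ℝ≥0∞) :
    ∑' n, w n * ∑' y, p y * f (greedyStep C n y) = ∑' n, w n * f n := by
  have key : ∀ (q : PMF ℕ), ∑' n, q n * f n = ∫⁻ n, f n ∂q.toMeasure := fun q =>
    (lintegral_pmf q f).symm
  conv_rhs => rw [← hw]
  simp only [PMF.bind_apply]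
  simp_rw [← ENNReal.tsum_mul_right]
  rw [ENNReal.tsum_comm]
  refine tsum_congr fun n => ?_
  simp_rw [mul_assoc]
  rw [ENNReal.tsum_mul_left]
  congr 1
  rw [key, ← PMF.toMeasure_map, lintegral_map measurable_from_top measurable_from_top,
    lintegral_pmf]
  exact measurable_from_top

/-- Stationarity propagated along the chain: peeling off the last arrival turns `f` into its
one-step average, whose `w`-mean is that of `f`. -/
lemma IsGreedyStationary.tsum_lintegral_greedyState {C : ℕ} {p w : PMF ℕ}
    (hw : IsGreedyStationary C p w) (s k : ℕ) (f : ℕ → ℝ≥0∞) :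
    ∑' n, w n * ∫⁻ v, f (greedyState C s n v k) ∂Measure.infinitePi (fun _ : ℕ => p.toMeasure)
      = ∑' n, w n * f n := by
  induction k generalizing f with
  | zero => simp [greedyState]
  | succ k ih =>
    simp only [greedyState]
    simp_rw [fun n => lintegral_greedyState_arrival p C s n k (fun m y => f (greedyStep C m y))]
    rw [ih fun m => ∑' y, p y * f (greedyStep C m y), hw.tsum_eq]

lemma ofReal_greedySamplingProb (p w : PMF ℕ) :
    ENNReal.ofReal (greedySamplingProb p w)
      = ∑' n, w n * ∑' y, p y * if greedyDecision n y then 1 else 0 := by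
  rw [greedySamplingProb, ENNReal.ofReal_toReal (PMF.apply_ne_top _ _), PMF.bind_apply]
  refine tsum_congr fun n => ?_
  rw [PMF.map_apply]
  congr 1
  refine tsum_congr fun y => ?_
  cases greedyDecision n y <;> simp

/-- Starting empty yields the fewest samples, so the mean is at most that for an initial state drawn
from `w`, which is exact by stationarity. No convergence or uniqueness for the chain is needed. -/
lemma IsGreedyStationary.lintegral_greedyCount_le {C : ℕ} {p w : PMF ℕ}
    (hw : IsGreedyStationary C p w) (s k : ℕ) :
    ∫⁻ v, (greedyCount C s 0 v k : ℝ≥0∞) ∂Measure.infinitePi (fun _ : ℕ => p.toMeasure)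
      ≤ k * ENNReal.ofReal (greedySamplingProb p w) := by
  set ν := Measure.infinitePi (fun _ : ℕ => p.toMeasure)
  have hstep : ∀ i, ∑' n, w n * ∫⁻ v, (if greedyDecision (greedyState C s n v i) (v (s + i))
      then 1 else 0 : ℝ≥0∞) ∂ν = ENNReal.ofReal (greedySamplingProb p w) := by
    intro i
    simp_rw [ν, fun n => lintegral_greedyState_arrival p C s n i
      (fun m y => if greedyDecision m y then 1 else 0)]
    rw [hw.tsum_lintegral_greedyState s i
      (fun m => ∑' y, p y * if greedyDecision m y then 1 else 0), ofReal_greedySamplingProb]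
  have hcount : ∀ n, ∫⁻ v, (greedyCount C s n v k : ℝ≥0∞) ∂ν = ∑ i ∈ Finset.range k,
      ∫⁻ v, (if greedyDecision (greedyState C s n v i) (v (s + i)) then 1 else 0 : ℝ≥0∞) ∂ν := by
    intro n
    rw [← lintegral_finsetSum]
    · refine lintegral_congr fun v => ?_
      simp [greedyCount]
    · intro i _
      exact (measurable_from_prod_countable_right
        (f := fun q : ℕ × ℕ => if greedyDecision q.1 q.2 then (1 : ℝ≥0∞) else 0)
          fun _ => measurable_from_top).comp
        ((measurable_greedyState C s n i).prodMk (measurable_pi_apply (s + i)))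
  calc ∫⁻ v, (greedyCount C s 0 v k : ℝ≥0∞) ∂ν
      = ∑' n, w n * ∫⁻ v, (greedyCount C s 0 v k : ℝ≥0∞) ∂ν := by
        rw [ENNReal.tsum_mul_right, w.tsum_coe, one_mul]
    _ ≤ ∑' n, w n * ∫⁻ v, (greedyCount C s n v k : ℝ≥0∞) ∂ν := by
        refine ENNReal.tsum_le_tsum fun n => ?_
        gcongr
        exact greedyCount_mono C s (Nat.zero_le n) _ k
    _ = ∑ i ∈ Finset.range k, ∑' n, w n * ∫⁻ v,
          (if greedyDecision (greedyState C s n v i) (v (s + i)) then 1 else 0 : ℝ≥0∞) ∂ν := by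
        simp_rw [hcount, Finset.mul_sum]
        exact (Summable.tsum_finsetSum fun _ _ => ENNReal.summable)
    _ = k * ENNReal.ofReal (greedySamplingProb p w) := by
        simp [hstep]

end Greedy

/-! ### Pathwise domination by the greedy strategy -/

section Comparison

variable (g : Strategy) (N C : ℕ)

lemma Strategy.rights_le (ω : Path) (k : ℕ) : g.rights N C ω k ≤ max N C := by
  cases k with
  | zero => simp [Strategy.rights]
  | succ k => exact (min_le_left _ _).trans (by exact_mod_cast le_max_right N C)

/-- Compared with an admissible strategy, the greedy one that starts with no rights holds fewer
rights, but the sum of the observations taken and the rights held falls short by at most the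
rights the former started with. -/
lemma Strategy.greedy_comparison {ω : Path} (h : ∀ k, 0 ≤ g.rights N C ω k) (s k : ℕ) :
    (greedyState C s 0 ω.2.2 k : ℤ) ≤ g.rights N C ω (s + k) ∧
    ((∑ i ∈ Finset.range k, if g.decision (s + i) ω then 1 else 0 : ℕ) : ℤ)
        + g.rights N C ω (s + k)
      ≤ greedyCount C s 0 ω.2.2 k + greedyState C s 0 ω.2.2 k + g.rights N C ω s := by
  induction k with
  | zero => exact ⟨by simpa [greedyState] using h s, by simp [greedyState, greedyCount]⟩
  | succ k ih =>
    obtain ⟨ih1, ih2⟩ := ih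
    have hpos := h (s + k + 1)
    have hr : g.rights N C ω (s + k + 1) = min (C : ℤ)
      (g.rights N C ω (s + k) + ω.2.2 (s + k) - (if g.decision (s + k) ω then 1 else 0)) := rfl
    rw [← add_assoc]
    simp only [greedyCount, Finset.sum_range_succ, greedyState, greedyStep, greedyDecision,
      decide_eq_true_eq] at ih2 ⊢
    rw [hr] at hpos ⊢
    push_cast at ih2 hpos ⊢
    -- Greedy holds fewer rights, so if it samples it loses no more to the capacity `C` than the
    -- other strategy does. If it does not sample, it has nothing to spend or lose, and
    -- admissibility keeps the other holding nonnegative.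
    split_ifs at hpos ⊢ <;> constructor <;> lia

lemma Strategy.count_le_greedyCount {ω : Path} (h : ∀ k, 0 ≤ g.rights N C ω k) (s k : ℕ) :
    (∑ i ∈ Finset.range k, if g.decision (s + i) ω then 1 else 0)
      ≤ greedyCount C s 0 ω.2.2 k + max N C := by
  have h1 := g.greedy_comparison N C h s k
  have h2 := g.rights_le N C ω s
  push_cast at h1 h2
  zify
  lia

/-- An admissible strategy is dominated by the greedy one restarted every `B` slots. -/
lemma Strategy.count_le_sum_greedyCount {ω : Path} (h : ∀ k, 0 ≤ g.rights N C ω k) (s B J : ℕ) :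
    (∑ i ∈ Finset.range (J * B), if g.decision (s + i) ω then 1 else 0)
      ≤ ∑ j ∈ Finset.range J, (greedyCount C (s + j * B) 0 ω.2.2 B + max N C) := by
  induction J with
  | zero => simp
  | succ J ih =>
    rw [Nat.succ_mul, Finset.sum_range_add, Finset.sum_range_succ]
    refine add_le_add ih ?_
    simpa [add_assoc] using g.count_le_greedyCount N C h (s + J * B) B

end Comparison

/-! ### Weak law for the greedy counts over blocks -/

section BlockLaw

/-- Chebyshev's inequality for sums of bounded pairwise independent variables. -/
lemma measure_sum_ge_le {Ω : Type*} [MeasurableSpace Ω] (P : Measure Ω) [IsProbabilityMeasure P]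
    {X : ℕ → Ω → ℝ} (hX : ∀ j, Measurable (X j)) {b m δ : ℝ} (hb : ∀ j ω, X j ω ∈ Set.Icc 0 b)
    (hm : ∀ j, ∫ ω, X j ω ∂P ≤ m) (hind : Pairwise fun i j => IndepFun (X i) (X j) P)
    (hδ : 0 < δ) {J : ℕ} (hJ : 0 < J) :
    P {ω | J * (m + δ) ≤ ∑ j ∈ Finset.range J, X j ω} ≤ ENNReal.ofReal (b ^ 2 / (J * δ ^ 2)) := by
  have hL2 : ∀ j, MemLp (X j) 2 P := fun j =>
    MemLp.of_bound (hX j).aestronglyMeasurable b <| ae_of_all _ fun ω => by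
      rw [Real.norm_eq_abs, abs_of_nonneg (hb j ω).1]; exact (hb j ω).2
  have hvar : Var[∑ j ∈ Finset.range J, X j; P] ≤ J * b ^ 2 := by
    rw [IndepFun.variance_sum (fun j _ => hL2 j) fun i _ j _ hij => hind hij]
    calc _ ≤ ∑ _j ∈ Finset.range J, b ^ 2 := by
          refine Finset.sum_le_sum fun j _ => ?_
          have := variance_le_sq_of_bounded (μ := P) (X := X j) (a := 0) (b := b)
            (ae_of_all _ fun ω => hb j ω) (hX j).aemeasurable
          nlinarith [sq_nonneg b]
      _ = _ := by simp
  have hJδ : 0 < J * δ := by positivity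
  have hSL2 : MemLp (∑ j ∈ Finset.range J, X j) 2 P := memLp_finsetSum' _ fun j _ => hL2 j
  have hmean : P[∑ j ∈ Finset.range J, X j] ≤ J * m := by
    have : P[∑ j ∈ Finset.range J, X j] = ∑ j ∈ Finset.range J, ∫ ω, X j ω ∂P := by
      rw [← integral_finsetSum]
      · simp
      · exact fun j _ => (hL2 j).integrable one_le_two
    rw [this]
    exact (Finset.sum_le_sum fun j _ => hm j).trans (by simp)
  calc P {ω | J * (m + δ) ≤ ∑ j ∈ Finset.range J, X j ω}
      ≤ P {ω | J * δ ≤ |(∑ j ∈ Finset.range J, X j) ω - P[∑ j ∈ Finset.range J, X j]|} := by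
        refine measure_mono fun ω hω => ?_
        simp only [Set.mem_ofPred_eq, Finset.sum_apply] at hω hmean ⊢
        refine le_trans ?_ (le_abs_self _)
        linarith
    _ ≤ ENNReal.ofReal (Var[∑ j ∈ Finset.range J, X j; P] / (J * δ) ^ 2) :=
        meas_ge_le_variance_div_sq hSL2 hJδ
    _ ≤ ENNReal.ofReal (b ^ 2 / (J * δ ^ 2)) := by
        refine ENNReal.ofReal_le_ofReal ?_
        have hJ' : (0 : ℝ) < J := by exact_mod_cast hJ
        rw [div_le_div_iff₀ (by positivity) (by positivity)]
        calc _ ≤ (J * b ^ 2) * (J * δ ^ 2) := by gcongr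
          _ = _ := by ring

/-- Restarting with no rights makes each count a function of the arrivals in its own block, and the
blocks are disjoint. The extension by zero expresses this through finitely many coordinates. -/
lemma indepFun_greedyCount (p : PMF ℕ) (C s B : ℕ) :
    Pairwise fun i j => IndepFun (fun v => (greedyCount C (s + i * B) 0 v B : ℝ))
      (fun v => (greedyCount C (s + j * B) 0 v B : ℝ))
      (Measure.infinitePi fun _ : ℕ => p.toMeasure) := by
  classical
  have hiid : iIndepFun (fun (i : ℕ) (v : ℕ → ℕ) => v i)
      (Measure.infinitePi fun _ : ℕ => p.toMeasure) :=
    iIndepFun_infinitePi (P := fun _ : ℕ => p.toMeasure) (X := fun _ y => y)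
      fun _ => measurable_id
  set block : ℕ → Finset ℕ := fun i => Finset.Ico (s + i * B) (s + i * B + B)
  set ext : (i : ℕ) → (block i → ℕ) → ℕ → ℕ := fun i u k => if h : k ∈ block i then u ⟨k, h⟩ else 0
  have hext : ∀ i, Measurable (ext i) := fun i => by
    refine measurable_pi_lambda _ fun k => ?_
    by_cases h : k ∈ block i
    · simpa [ext, h] using measurable_pi_apply _
    · simp [ext, h]
  have hφ : ∀ i, Measurable fun u : block i → ℕ =>
      (greedyCount C (s + i * B) 0 (ext i u) B : ℝ) := fun i =>
    (measurable_from_top (f := fun n : ℕ => (n : ℝ))).comp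
      ((measurable_greedyCount C _ 0 B).comp (hext i))
  have heq : ∀ i, (fun v => (greedyCount C (s + i * B) 0 v B : ℝ))
      = (fun u : block i → ℕ => (greedyCount C (s + i * B) 0 (ext i u) B : ℝ)) ∘
        fun (v : ℕ → ℕ) (k : block i) => v k := by
    intro i
    funext v
    simp only [Function.comp]
    rw [greedyCount_congr C _ 0 B fun k hk => ?_]
    have : s + i * B + k ∈ block i := by simp [block, hk]
    simp [ext, this]
  intro i j hij
  have hdisj : Disjoint (block i) (block j) := by
    refine Finset.disjoint_left.2 fun k hi hj => ?_
    simp only [block, Finset.mem_Ico] at hi hj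
    rcases lt_or_gt_of_ne hij with h | h
    · have := Nat.mul_le_mul_right B (Nat.succ_le_of_lt h)
      rw [Nat.succ_mul] at this
      lia
    · have := Nat.mul_le_mul_right B (Nat.succ_le_of_lt h)
      rw [Nat.succ_mul] at this
      lia
  have := (hiid.indepFun_finset (block i) (block j) hdisj fun k => measurable_pi_apply k).comp
    (hφ i) (hφ j)
  rw [heq i, heq j]
  exact this

end BlockLaw

/-! ### Uniform bound on the sampling rate -/

section SamplingRate

variable (f₀ f₁ : Pdf) (p : PMF ℕ) (g : Strategy)

lemma greedySamplingProb_mem_Icc (p w : PMF ℕ) : greedySamplingProb p w ∈ Set.Icc 0 1 :=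
  ⟨ENNReal.toReal_nonneg, ENNReal.toReal_le_of_le_ofReal zero_le_one
    (by rw [ENNReal.ofReal_one]; exact PMF.coe_le_one _ _)⟩

/-- The number of observations taken in the slots `j + 1, …, j + n`. -/
def sampleCount (j n : ℕ) (z : (ℕ → ℝ) × (ℕ → ℕ)) : ℕ :=
  ∑ i ∈ Finset.range n, if g.sampled (j + i) z then 1 else 0

lemma IsGreedyStationary.measure_sum_greedyCount_ge_le {C : ℕ} {p w : PMF ℕ}
    (hw : IsGreedyStationary C p w) (s : ℕ) {B J : ℕ} (hJ : 0 < J) {δ : ℝ}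
    (hδ : 0 < δ) :
    (Measure.infinitePi fun _ : ℕ => p.toMeasure)
        {v | J * (B * greedySamplingProb p w + δ)
          ≤ ∑ j ∈ Finset.range J, (greedyCount C (s + j * B) 0 v B : ℝ)}
      ≤ ENNReal.ofReal ((B : ℝ) ^ 2 / (J * δ ^ 2)) := by
  have hmeas : ∀ j, Measurable fun v => (greedyCount C (s + j * B) 0 v B : ℝ) := fun j =>
    (measurable_from_top (f := fun n : ℕ => (n : ℝ))).comp (measurable_greedyCount C _ 0 B)
  refine measure_sum_ge_le _ hmeas (fun j v => ⟨by positivity, ?_⟩) (fun j => ?_)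
    (indepFun_greedyCount p C s B) hδ hJ
  · exact_mod_cast greedyCount_le C _ 0 v B
  · have h0 := (greedySamplingProb_mem_Icc p w).1
    rw [integral_eq_lintegral_of_nonneg_ae (ae_of_all _ fun v => by positivity)
      (hmeas j).aestronglyMeasurable]
    refine ENNReal.toReal_le_of_le_ofReal (by positivity) ?_
    rw [ENNReal.ofReal_mul (by positivity), ENNReal.ofReal_natCast]
    simpa using hw.lintegral_greedyCount_le (s + j * B) B

/-- No admissible strategy samples at a rate exceeding the greedy one. -/
lemma IsGreedyStationary.exists_measure_sampleCount_le {C : ℕ} {p w : PMF ℕ}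
    (hw : IsGreedyStationary C p w) (N j : ℕ) {δ η : ℝ} (hδ : 0 < δ) (hη : 0 < η) :
    ∃ n₀ : ℕ, ∀ n ≥ n₀, ∀ g : Strategy,
      (∀ᵐ z ∂conditionalLaw f₀ f₁ p (j + 1), ∀ k, 0 ≤ g.rights N C (1, z) k) →
      conditionalLaw f₀ f₁ p (j + 1)
        {z | (greedySamplingProb p w + δ) * n < sampleCount g j n z} ≤ ENNReal.ofReal η := by
  set q := greedySamplingProb p w
  have hq0 : 0 ≤ q := (greedySamplingProb_mem_Icc p w).1
  set M := max N C
  -- Each restart costs up to `M` extra samples; blocks this long make that at most `δ / 4` per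
  -- slot. Below, `n₁` absorbs rounding up to whole blocks and `n₂` brings the Chebyshev bound below
  -- `η`.
  obtain ⟨B, hB⟩ := exists_nat_gt (4 * (M : ℝ) / δ)
  have hB0 : (0 : ℝ) < B := lt_of_le_of_lt (by positivity) hB
  have hBpos : 0 < B := by exact_mod_cast hB0
  have hMB : (M : ℝ) ≤ B * δ / 4 := by
    rw [div_lt_iff₀ hδ] at hB; linarith
  obtain ⟨n₁, hn₁⟩ := exists_nat_gt (B * (q + δ / 2) / (δ / 2))
  obtain ⟨n₂, hn₂⟩ := exists_nat_gt (16 * B / (δ ^ 2 * η))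
  refine ⟨max n₁ n₂, fun n hn g hg => ?_⟩
  have hn1 : B * (q + δ / 2) ≤ n * (δ / 2) := by
    have : (n₁ : ℝ) ≤ n := by exact_mod_cast (le_max_left _ _).trans hn
    rw [div_lt_iff₀ (by positivity)] at hn₁
    nlinarith
  have hn2 : 16 * B ≤ n * (δ ^ 2 * η) := by
    have : (n₂ : ℝ) ≤ n := by exact_mod_cast (le_max_right _ _).trans hn
    rw [div_lt_iff₀ (by positivity)] at hn₂
    nlinarith [show 0 < δ ^ 2 * η by positivity]
  set J := n / B + 1
  have hJ0 : (0 : ℝ) < J := by positivity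
  have hnJ : n ≤ J * B := by
    have := Nat.div_add_mod n B
    have := Nat.mod_lt n hBpos
    simp only [J, Nat.succ_mul]
    nlinarith
  have hJn : (J : ℝ) * B ≤ n + B := by
    have : J * B ≤ n + B := by
      simp only [J, Nat.succ_mul]
      exact Nat.add_le_add_right (Nat.div_mul_le_self n B) B
    exact_mod_cast this
  have hnJ' : (n : ℝ) ≤ J * B := by exact_mod_cast hnJ
  set S : Set (ℕ → ℕ) := {v | J * (B * q + B * δ / 4)
    ≤ ∑ i ∈ Finset.range J, (greedyCount C (j + i * B) 0 v B : ℝ)} with hS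
  have hSm : MeasurableSet S := by
    refine measurableSet_le measurable_const (Finset.measurable_sum _ fun i _ => ?_)
    exact (measurable_from_top (f := fun n : ℕ => (n : ℝ))).comp (measurable_greedyCount C _ 0 B)
  calc conditionalLaw f₀ f₁ p (j + 1) {z | (q + δ) * n < sampleCount g j n z}
      ≤ conditionalLaw f₀ f₁ p (j + 1) (Prod.snd ⁻¹' S) := by
        refine measure_mono_ae ?_
        filter_upwards [hg] with z hz hcount
        change (q + δ) * n < sampleCount g j n z at hcount
        change J * (B * q + B * δ / 4) ≤ ∑ i ∈ Finset.range J, (greedyCount C (j + i * B) 0 z.2 B : ℝ)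
        have h1 : sampleCount g j n z ≤ ∑ i ∈ Finset.range (J * B),
            if g.decision (j + i) (1, z) then 1 else 0 :=
          Finset.sum_le_sum_of_subset (Finset.range_mono hnJ)
        have h2 := h1.trans (g.count_le_sum_greedyCount N C hz j B J)
        have h3 : (sampleCount g j n z : ℝ)
            ≤ ∑ i ∈ Finset.range J, (greedyCount C (j + i * B) 0 z.2 B : ℝ) + J * M := by
          have : (sampleCount g j n z : ℝ)
            ≤ ((∑ i ∈ Finset.range J, (greedyCount C (j + i * B) 0 z.2 B + M) : ℕ) : ℝ) := by
            exact_mod_cast h2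
          simpa [Finset.sum_add_distrib] using this
        have h4 : J * (B * q + B * δ / 4) + J * M ≤ (q + δ) * n := by
          calc J * (B * q + B * δ / 4) + J * M ≤ J * (B * q + B * δ / 4) + J * (B * δ / 4) := by
                gcongr
            _ = (J * B) * (q + δ / 2) := by ring
            _ ≤ (n + B) * (q + δ / 2) := by gcongr
            _ ≤ (q + δ) * n := by linarith
        linarith
    _ = (Measure.infinitePi fun _ : ℕ => p.toMeasure) S := by
        rw [conditionalLaw_eq]
        exact measurePreserving_snd.measure_preimage hSm.nullMeasurableSet
    _ ≤ ENNReal.ofReal ((B : ℝ) ^ 2 / (J * (B * δ / 4) ^ 2)) :=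
        hw.measure_sum_greedyCount_ge_le j (Nat.succ_pos _) (by positivity)
    _ ≤ ENNReal.ofReal η := by
        refine ENNReal.ofReal_le_ofReal ?_
        rw [div_le_iff₀ (by positivity)]
        have : 16 ≤ J * (δ ^ 2 * η) := by
          have : B * 16 ≤ B * (J * (δ ^ 2 * η)) := by
            calc B * 16 = 16 * (B : ℝ) := by ring
              _ ≤ n * (δ ^ 2 * η) := hn2
              _ ≤ (J * B) * (δ ^ 2 * η) := by gcongr
              _ = _ := by ring
          exact le_of_mul_le_mul_left this hB0
        calc (B : ℝ) ^ 2 = B ^ 2 * 16 / 16 := by ring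
          _ ≤ B ^ 2 * (J * (δ ^ 2 * η)) / 16 := by gcongr
          _ = _ := by ring

end SamplingRate

/-! ### Upper bound for the accumulated log-likelihood ratio -/

section LogLikelihood

variable (f₀ f₁ : Pdf) (p : PMF ℕ) (g : Strategy)

/-- The sum over the slots `j + 1, …, j + n` in which the strategy samples of `φ` of the
observed value. -/
noncomputable def sampledSum (φ : ℝ → ℝ) (j n : ℕ) (z : (ℕ → ℝ) × (ℕ → ℕ)) : ℝ :=
  ∑ i ∈ Finset.range n, if g.sampled (j + i) z then φ (z.1 (j + i)) else 0

lemma measurable_sampledSum {φ : ℝ → ℝ} (hφ : Measurable φ) (j n : ℕ) :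
    Measurable (sampledSum g φ j n) := by
  refine Finset.measurable_sum _ fun i _ => ?_
  refine Measurable.ite ?_ (by fun_prop) measurable_const
  exact (g.measurable_sampled (j + i)) (measurableSet_singleton true)

lemma sampledProd_ofReal_exp (φ : ℝ → ℝ) (j n : ℕ) (z : (ℕ → ℝ) × (ℕ → ℕ)) :
    sampledProd g (fun y => ENNReal.ofReal (Real.exp (φ y))) j n z
      = ENNReal.ofReal (Real.exp (sampledSum g φ j n z)) := by
  unfold sampledProd sampledSum
  rw [Real.exp_sum, ENNReal.ofReal_prod_of_nonneg fun i _ => (Real.exp_pos _).le]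
  refine Finset.prod_congr rfl fun i _ => ?_
  split_ifs <;> simp

/-- Hoeffding's inequality for sums over predictably sampled slots. -/
lemma measure_sampledSum_sub_ge_le {ψ : ℝ → ℝ} (hψ : Measurable ψ) {M δ : ℝ} (hM : 0 < M)
    (hb : ∀ y, ψ y ∈ Set.Icc (-M) M) (hδ : 0 < δ) (j n : ℕ) :
    conditionalLaw f₀ f₁ p (j + 1)
        {z | δ * n ≤ sampledSum g (fun y => ψ y - ∫ x, ψ x ∂f₁.law) j n z}
      ≤ ENNReal.ofReal (Real.exp (-(δ ^ 2 / (2 * M ^ 2)) * n)) := by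
  set m := ∫ x, ψ x ∂f₁.law
  -- The maximiser of the Chernoff exponent `s * δ - M ^ 2 * s ^ 2 / 2`; values in `[-M, M]` are
  -- sub-Gaussian with variance parameter `M ^ 2`.
  set s := δ / M ^ 2 with hs
  have hs0 : 0 < s := by positivity
  have hsub := hasSubgaussianMGF_of_mem_Icc (μ := f₁.law) hψ.aemeasurable (ae_of_all _ hb)
  have hmgf := hsub.mgf_le s
  have hc : (((‖M - -M‖₊ / 2) ^ 2 : NNReal) : ℝ) = M ^ 2 := by
    push_cast
    rw [Real.norm_eq_abs, abs_of_pos (by linarith)]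
    ring
  rw [hc] at hmgf
  have hF : ∫⁻ y, ENNReal.ofReal (Real.exp (s * (ψ y - m))) ∂f₁.law
      ≤ ENNReal.ofReal (Real.exp (M ^ 2 * s ^ 2 / 2)) := by
    rw [← ofReal_integral_eq_lintegral_ofReal (hsub.integrable_exp_mul s)
      (ae_of_all _ fun _ => (Real.exp_pos _).le)]
    exact ENNReal.ofReal_le_ofReal hmgf
  have hFm : Measurable fun y => ENNReal.ofReal (Real.exp (s * (ψ y - m))) := by fun_prop
  have hexp := lintegral_sampledProd_le f₀ f₁ p g hFm
    (by rw [← ENNReal.ofReal_one]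
        exact ENNReal.ofReal_le_ofReal (Real.one_le_exp (by positivity))) hF j n
  have hscale : ∀ z, sampledSum g (fun y => s * (ψ y - m)) j n z
      = s * sampledSum g (fun y => ψ y - m) j n z := by
    intro z
    simp only [sampledSum, Finset.mul_sum, mul_ite, mul_zero]
  have hE : ENNReal.ofReal (Real.exp (s * (δ * n))) ≠ 0 := by simp [Real.exp_pos]
  calc conditionalLaw f₀ f₁ p (j + 1) {z | δ * n ≤ sampledSum g (fun y => ψ y - m) j n z}
      ≤ conditionalLaw f₀ f₁ p (j + 1) {z | ENNReal.ofReal (Real.exp (s * (δ * n)))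
          ≤ sampledProd g (fun y => ENNReal.ofReal (Real.exp (s * (ψ y - m)))) j n z} := by
        refine measure_mono fun z hz => ?_
        change ENNReal.ofReal _ ≤ _
        rw [sampledProd_ofReal_exp, hscale]
        exact ENNReal.ofReal_le_ofReal (Real.exp_le_exp.2 (mul_le_mul_of_nonneg_left hz hs0.le))
    _ ≤ (∫⁻ z, sampledProd g (fun y => ENNReal.ofReal (Real.exp (s * (ψ y - m)))) j n z
          ∂conditionalLaw f₀ f₁ p (j + 1)) / ENNReal.ofReal (Real.exp (s * (δ * n))) :=
        meas_ge_le_lintegral_div (measurable_sampledProd g hFm j n).aemeasurable hE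
          ENNReal.ofReal_ne_top
    _ ≤ ENNReal.ofReal (Real.exp (M ^ 2 * s ^ 2 / 2)) ^ n
          / ENNReal.ofReal (Real.exp (s * (δ * n))) := by gcongr
    _ = ENNReal.ofReal (Real.exp (-(δ ^ 2 / (2 * M ^ 2)) * n)) := by
        rw [← ENNReal.ofReal_pow (Real.exp_pos _).le, ← ENNReal.ofReal_div_of_pos (Real.exp_pos _),
          ← Real.exp_nat_mul, ← Real.exp_sub]
        congr 2
        rw [hs]
        field_simp
        ring

lemma map_signal_conditionalLaw (j i : ℕ) :
    MeasurePreserving (fun z : (ℕ → ℝ) × (ℕ → ℕ) => z.1 (j + i))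
      (conditionalLaw f₀ f₁ p (j + 1)) f₁.law := by
  have h : siteLaw f₀ f₁ (j + 1) (j + i) = f₁.law := by simp [siteLaw]
  rw [conditionalLaw_eq, ← h]
  exact (measurePreserving_eval_infinitePi (siteLaw f₀ f₁ (j + 1)) (j + i)).comp
    measurePreserving_fst

/-- Markov's inequality for the sum of a function of the post-change signal. -/
lemma measure_sum_signal_ge_le {φ : ℝ → ℝ} (hφ : Measurable φ) (h0 : ∀ y, 0 ≤ φ y)
    (hint : Integrable φ f₁.law) {δ : ℝ} (hδ : 0 < δ) (j : ℕ) {n : ℕ} (hn : 0 < n) :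
    conditionalLaw f₀ f₁ p (j + 1) {z | δ * n ≤ ∑ i ∈ Finset.range n, φ (z.1 (j + i))}
      ≤ ENNReal.ofReal ((∫ y, φ y ∂f₁.law) / δ) := by
  have hn' : (0 : ℝ) < n := by exact_mod_cast hn
  have hm : Measurable fun z : (ℕ → ℝ) × (ℕ → ℕ) =>
      ∑ i ∈ Finset.range n, ENNReal.ofReal (φ (z.1 (j + i))) := by fun_prop
  calc conditionalLaw f₀ f₁ p (j + 1) {z | δ * n ≤ ∑ i ∈ Finset.range n, φ (z.1 (j + i))}
      ≤ conditionalLaw f₀ f₁ p (j + 1) {z | ENNReal.ofReal (δ * n)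
          ≤ ∑ i ∈ Finset.range n, ENNReal.ofReal (φ (z.1 (j + i)))} := by
        refine measure_mono fun z hz => ?_
        change ENNReal.ofReal _ ≤ _
        rw [← ENNReal.ofReal_sum_of_nonneg fun i _ => h0 _]
        exact ENNReal.ofReal_le_ofReal hz
    _ ≤ (∫⁻ z, ∑ i ∈ Finset.range n, ENNReal.ofReal (φ (z.1 (j + i)))
          ∂conditionalLaw f₀ f₁ p (j + 1)) / ENNReal.ofReal (δ * n) :=
        meas_ge_le_lintegral_div hm.aemeasurable (by simp; positivity) ENNReal.ofReal_ne_top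
    _ = ENNReal.ofReal ((∫ y, φ y ∂f₁.law) / δ) := by
        rw [lintegral_finsetSum _ fun i _ => by fun_prop]
        have : ∀ i, ∫⁻ z, ENNReal.ofReal (φ (z.1 (j + i))) ∂conditionalLaw f₀ f₁ p (j + 1)
            = ENNReal.ofReal (∫ y, φ y ∂f₁.law) := by
          intro i
          rw [(map_signal_conditionalLaw f₀ f₁ p j i).lintegral_comp
            (f := fun y => ENNReal.ofReal (φ y)) (by fun_prop),
            ← ofReal_integral_eq_lintegral_ofReal hint (ae_of_all _ h0)]
        simp only [this, Finset.sum_const, Finset.card_range, nsmul_eq_mul]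
        rw [← ENNReal.ofReal_natCast, ← ENNReal.ofReal_mul hn'.le,
          ← ENNReal.ofReal_div_of_pos (by positivity)]
        congr 1
        field_simp

/-- Finite divergence gives only a first moment of the log-likelihood ratio; clipping it makes
exponential bounds available at a small cost in `L¹`. -/
lemma exists_truncation {φ : ℝ → ℝ} (hφ : Measurable φ) {μ : Measure ℝ} (hint : Integrable φ μ)
    {θ : ℝ} (hθ : 0 < θ) :
    ∃ M : ℝ, 0 < M ∧ ∫ y, |φ y - max (-M) (min (φ y) M)| ∂μ ≤ θ := by
  have hlim : Tendsto (fun n : ℕ => ∫ y, |φ y - max (-(n : ℝ)) (min (φ y) n)| ∂μ) atTop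
      (𝓝 (∫ _, 0 ∂μ)) := by
    refine tendsto_integral_of_dominated_convergence (fun y => |φ y|)
      (fun n => (by fun_prop : Measurable _).aestronglyMeasurable) hint.abs
      (fun n => ae_of_all _ fun y => ?_) (ae_of_all _ fun y => ?_)
    · have hn : (0 : ℝ) ≤ n := by positivity
      rw [Real.norm_eq_abs, abs_abs]
      rcases le_total (φ y) n with h | h
      · rw [min_eq_left h]
        rcases le_total (-(n : ℝ)) (φ y) with h' | h'
        · rw [max_eq_right h']; simp
        · rw [max_eq_left h', abs_of_nonpos (by linarith), abs_of_nonpos (by linarith)]; linarith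
      · rw [min_eq_right h, max_eq_right (by linarith), abs_of_nonneg (by linarith),
          abs_of_nonneg (by linarith)]
        linarith
    · obtain ⟨k, hk⟩ := exists_nat_ge |φ y|
      refine tendsto_const_nhds.congr' ?_
      filter_upwards [eventually_ge_atTop k] with n hn
      have hkn : |φ y| ≤ n := hk.trans (by exact_mod_cast hn)
      rw [abs_le] at hkn
      rw [min_eq_left hkn.2, max_eq_right hkn.1]; simp
  rw [integral_zero] at hlim
  obtain ⟨n, hn, hn0⟩ := ((hlim.eventually (ge_mem_nhds hθ)).and (eventually_gt_atTop 0)).exists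
  exact ⟨n, by exact_mod_cast hn0, hn⟩

/-- The log-likelihood ratio collected in `n` slots after the change exceeds its largest
possible mean by a factor of order `n` with vanishing probability, whatever the strategy. -/
lemma IsGreedyStationary.exists_measure_llr_le {C : ℕ} {p w : PMF ℕ}
    (hw : IsGreedyStationary C p w) (hint : Integrable (llr f₁.law f₀.law) f₁.law)
    (hD : 0 ≤ ∫ y, llr f₁.law f₀.law y ∂f₁.law) (N j : ℕ)
    {δ η : ℝ} (hδ : 0 < δ) (hη : 0 < η) :
    ∃ n₀ : ℕ, ∀ n ≥ n₀, ∀ g : Strategy,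
      (∀ᵐ z ∂conditionalLaw f₀ f₁ p (j + 1), ∀ k, 0 ≤ g.rights N C (1, z) k) →
      conditionalLaw f₀ f₁ p (j + 1)
        {z | (greedySamplingProb p w * (∫ y, llr f₁.law f₀.law y ∂f₁.law) + δ) * n
          < sampledSum g (llr f₁.law f₀.law) j n z} ≤ ENNReal.ofReal η := by
  set φ := llr f₁.law f₀.law with hφdef
  set D := ∫ y, φ y ∂f₁.law
  set q := greedySamplingProb p w
  obtain ⟨hq0, hq1⟩ := greedySamplingProb_mem_Icc p w
  change 0 ≤ q at hq0
  change q ≤ 1 at hq1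
  have hφ : Measurable φ := measurable_llr _ _
  -- The first bound keeps the bias from clipping below `δ / 8`; the second makes the Markov bound
  -- `θ / (δ / 4)` at most `η / 3`.
  set θ := min (δ / 8) (δ * η / 12)
  have hθ : 0 < θ := by positivity
  have hθ1 : θ ≤ δ / 8 := min_le_left _ _
  have hθ2 : θ ≤ δ * η / 12 := min_le_right _ _
  obtain ⟨M, hM, hMθ⟩ := exists_truncation hφ hint hθ
  set ψ : ℝ → ℝ := fun y => max (-M) (min (φ y) M) with hψdef
  have hψ : Measurable ψ := by fun_prop
  have hψb : ∀ y, ψ y ∈ Set.Icc (-M) M := fun y =>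
    ⟨le_max_left _ _, max_le (by linarith) (min_le_right _ _)⟩
  have hψint : Integrable ψ f₁.law := Integrable.of_mem_Icc (-M) M hψ.aemeasurable
    (ae_of_all _ hψb)
  set m := ∫ y, ψ y ∂f₁.law
  have hm : m ≤ D + θ := by
    have h1 : D - m = ∫ y, (φ y - ψ y) ∂f₁.law := (integral_sub hint hψint).symm
    have h2 : |∫ y, (φ y - ψ y) ∂f₁.law| ≤ ∫ y, |φ y - ψ y| ∂f₁.law := abs_integral_le_integral_abs
    have h3 := (abs_le.1 (h2.trans hMθ)).1
    linarith
  set δ' := δ / (4 * (D + θ))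
  have hδ' : 0 < δ' := by positivity
  have hδ'' : δ' * (D + θ) = δ / 4 := by
    simp only [δ']; field_simp
  obtain ⟨n₁, hn₁⟩ := hw.exists_measure_sampleCount_le f₀ f₁ N j hδ' (show 0 < η / 3 by positivity)
  have hlim : Tendsto (fun n : ℕ => Real.exp (-((δ / 4) ^ 2 / (2 * M ^ 2)) * n)) atTop (𝓝 0) := by
    refine Real.tendsto_exp_atBot.comp ?_
    refine Tendsto.const_mul_atTop_of_neg ?_ tendsto_natCast_atTop_atTop
    have : 0 < (δ / 4) ^ 2 / (2 * M ^ 2) := by positivity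
    linarith
  obtain ⟨n₂, hn₂⟩ := eventually_atTop.1
    (hlim.eventually (ge_mem_nhds (show 0 < η / 3 by positivity)))
  refine ⟨max 1 (max n₁ n₂), fun n hn g hg => ?_⟩
  have hn1 : 0 < n := lt_of_lt_of_le one_pos ((le_max_left _ _).trans hn)
  have hcount := hn₁ n ((le_max_left _ _).trans ((le_max_right _ _).trans hn)) g hg
  have hhoef := (measure_sampledSum_sub_ge_le f₀ f₁ p g hψ hM hψb
    (show 0 < δ / 4 by positivity) j n).trans (ENNReal.ofReal_le_ofReal
      (hn₂ n ((le_max_right _ _).trans ((le_max_right _ _).trans hn))))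
  have htail := (measure_sum_signal_ge_le f₀ f₁ p (φ := fun y => |φ y - ψ y|) (by fun_prop)
    (fun _ => abs_nonneg _) (hint.sub hψint).abs (show 0 < δ / 4 by positivity) j hn1).trans
    (ENNReal.ofReal_le_ofReal (show _ ≤ η / 3 by
      rw [div_le_iff₀ (by positivity)]
      refine hMθ.trans ?_
      linarith))
  set P := conditionalLaw f₀ f₁ p (j + 1)
  calc P {z | (q * D + δ) * n < sampledSum g φ j n z}
      ≤ P ({z | (q + δ') * n < sampleCount g j n z} ∪
          ({z | δ / 4 * n ≤ sampledSum g (fun y => ψ y - m) j n z} ∪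
            {z | δ / 4 * n ≤ ∑ i ∈ Finset.range n, |φ (z.1 (j + i)) - ψ (z.1 (j + i))|})) := by
        refine measure_mono fun z hz => ?_
        -- Off the three bad events the centred clipped sum and the clipping error each contribute
        -- less than `δ / 4 * n`. The drift is at most `(D + θ) * (q + δ') * n`, hence at most `(q *
        -- D + δ / 2) * n`.
        by_contra hcon
        simp only [Set.mem_union, Set.mem_ofPred_eq, not_or, not_le, not_lt] at hcon
        obtain ⟨h1, h2, h3⟩ := hcon
        change (q * D + δ) * n < sampledSum g φ j n z at hz
        have hdecomp : sampledSum g φ j n z ≤ sampledSum g (fun y => ψ y - m) j n z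
            + m * sampleCount g j n z
            + ∑ i ∈ Finset.range n, |φ (z.1 (j + i)) - ψ (z.1 (j + i))| := by
          simp only [sampledSum, sampleCount]
          push_cast
          rw [Finset.mul_sum, ← Finset.sum_add_distrib, ← Finset.sum_add_distrib]
          refine Finset.sum_le_sum fun i _ => ?_
          split_ifs
          · have := le_abs_self (φ (z.1 (j + i)) - ψ (z.1 (j + i)))
            linarith
          · simp
        have hmc : m * sampleCount g j n z ≤ (D + θ) * ((q + δ') * n) := by gcongr
        have hn0 : (0 : ℝ) ≤ n := by positivity
        have hqθ : q * θ ≤ δ / 8 := by nlinarith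
        have : (D + θ) * ((q + δ') * n) ≤ (q * D + δ / 2) * n := by
          rw [← mul_assoc]
          refine mul_le_mul_of_nonneg_right ?_ hn0
          nlinarith
        nlinarith
    _ ≤ ENNReal.ofReal (η / 3) + (ENNReal.ofReal (η / 3) + ENNReal.ofReal (η / 3)) :=
        (measure_union_le _ _).trans (add_le_add hcount
          ((measure_union_le _ _).trans (add_le_add hhoef htail)))
    _ = ENNReal.ofReal η := by
        rw [← ENNReal.ofReal_add (by positivity) (by positivity),
          ← ENNReal.ofReal_add (by positivity) (by positivity)]
        congr 1; ring

/-- An event determined by the observations is hardly more likely after the change than without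
it, unless the log-likelihood ratio is large. -/
lemma conditionalLaw_le_exp_mul_add (hac : f₁.law ≪ f₀.law)
    {A : Set ((ℕ → ℝ) × (ℕ → ℕ))} (hA : MeasurableSet A) {T : ℕ} (hAT : ObsInvariant g A T)
    (n j : ℕ) (a : ℝ) :
    conditionalLaw f₀ f₁ p (j + 1) A
      ≤ ENNReal.ofReal (Real.exp a) * conditionalLaw f₀ f₁ p (j + n + 1) A
        + conditionalLaw f₀ f₁ p (j + 1) {z | a < sampledSum g (llr f₁.law f₀.law) j n z} := by
  set φ := llr f₁.law f₀.law with hφdef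
  have hφ : Measurable φ := measurable_llr _ _
  set P := conditionalLaw f₀ f₁ p (j + 1)
  set S : Set ((ℕ → ℝ) × (ℕ → ℕ)) := {z | a < sampledSum g φ j n z} with hS
  have hSm : MeasurableSet S := measurableSet_lt measurable_const (measurable_sampledSum g hφ j n)
  have hneg : ∀ z, sampledSum g (fun y => -φ y) j n z = -sampledSum g φ j n z := by
    intro z
    simp only [sampledSum, ← Finset.sum_neg_distrib]
    refine Finset.sum_congr rfl fun i _ => ?_
    split_ifs <;> simp
  have hRm : Measurable fun y => ENNReal.ofReal (Real.exp (-φ y)) := by fun_prop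
  have h1A : Measurable (A.indicator (1 : (ℕ → ℝ) × (ℕ → ℕ) → ℝ≥0∞)) :=
    measurable_one.indicator hA
  calc P A ≤ P ((A \ S) ∪ S) := measure_mono (by
        rw [Set.sdiff_union_self]; exact Set.subset_union_left)
    _ ≤ P (A \ S) + P S := measure_union_le _ _
    _ ≤ _ := by
      gcongr
      calc P (A \ S) = ∫⁻ z, (A \ S).indicator 1 z ∂P := (lintegral_indicator_one (hA.diff hSm)).symm
        _ ≤ ∫⁻ z, ENNReal.ofReal (Real.exp a) *
              (sampledProd g (fun y => ENNReal.ofReal (Real.exp (-φ y))) j n z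
                * A.indicator 1 z) ∂P := by
            refine lintegral_mono fun z => ?_
            -- Off `S` the accumulated ratio is at most `a`, so `exp a` times the inverse likelihood
            -- ratio is at least one.
            by_cases hz : z ∈ A \ S
            · rw [Set.indicator_of_mem hz, Set.indicator_of_mem hz.1, sampledProd_ofReal_exp, hneg,
                Pi.one_apply, mul_one, ← ENNReal.ofReal_mul (Real.exp_pos _).le, ← Real.exp_add,
                ← ENNReal.ofReal_one]
              have : sampledSum g φ j n z ≤ a := not_lt.1 hz.2
              exact ENNReal.ofReal_le_ofReal (Real.one_le_exp (by linarith))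
            · rw [Set.indicator_of_notMem hz]; exact zero_le
        _ = ENNReal.ofReal (Real.exp a) *
              ∫⁻ z, sampledProd g (fun y => ENNReal.ofReal (Real.exp (-φ y))) j n z
                * A.indicator 1 z ∂P :=
            lintegral_const_mul _ ((measurable_sampledProd g hRm j n).mul h1A)
        _ ≤ _ := by
            gcongr
            exact lintegral_sampledProd_indicator_le f₀ f₁ p g hac hA hAT n j

end LogLikelihood

/-! ### Stopping times as functions of the observations -/

section StoppingTimes

variable (g : Strategy)

lemma Strategy.mem_iff_of_measurableSet_obsFiltration {k : ℕ} {s : Set Path}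
    (hs : MeasurableSet[g.obsFiltration k] s) {ω ω' : Path}
    (h : ∀ i < k, g.obs i ω = g.obs i ω') : ω ∈ s ↔ ω' ∈ s := by
  -- Enlarging to the discrete σ-algebra on the target loses nothing here: only membership as a
  -- function of the observations matters.
  have hle : (g.obsFiltration k : MeasurableSpace Path)
      ≤ MeasurableSpace.comap (fun ω (i : Fin k) => g.obs i ω) ⊤ := by
    refine iSup_le fun i => ?_
    rintro _ ⟨t, _, rfl⟩
    exact ⟨{u | u i ∈ t}, trivial, rfl⟩
  obtain ⟨t, -, rfl⟩ := hle s hs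
  have : (fun i : Fin k => g.obs i ω) = fun i : Fin k => g.obs i ω' := funext fun i => h i i.isLt
  simp only [Set.mem_preimage, this]

lemma Strategy.mem_iff_of_measurableSet_obsFiltrationWithZero {k : ℕ} {s : Set Path}
    (hs : MeasurableSet[g.obsFiltrationWithZero k] s) {ω ω' : Path}
    (h0 : changePoint ω = 0 ↔ changePoint ω' = 0)
    (h : ∀ i < k, g.obs i ω = g.obs i ω') : ω ∈ s ↔ ω' ∈ s := by
  have hle : (g.obsFiltrationWithZero k : MeasurableSpace Path)
      ≤ MeasurableSpace.comap (fun ω => (changePoint ω = 0, fun i : Fin k => g.obs i ω)) ⊤ := by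
    refine sup_le (iSup_le fun i => ?_) (MeasurableSpace.generateFrom_le ?_)
    · rintro _ ⟨t, _, rfl⟩
      exact ⟨{u | u.2 i ∈ t}, trivial, rfl⟩
    · rintro _ rfl
      exact ⟨{u | u.1}, trivial, rfl⟩
  obtain ⟨t, -, rfl⟩ := hle s hs
  have h1 : (fun i : Fin k => g.obs i ω) = fun i : Fin k => g.obs i ω' :=
    funext fun i => h i i.isLt
  have h2 : (changePoint ω = 0) = (changePoint ω' = 0) := propext h0
  simp only [Set.mem_preimage, h1, h2]

lemma enat_eq_of_forall_le_iff {a b : ℕ∞} (h : ∀ k : ℕ, a ≤ k ↔ b ≤ k) : a = b := by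
  refine le_antisymm ?_ ?_
  · cases b with
    | top => exact le_top
    | coe n => exact (h n).2 le_rfl
  · cases a with
    | top => exact le_top
    | coe n => exact (h n).1 le_rfl

lemma isStoppingTime_obsFiltrationWithZero {τ : Path → ℕ∞} {prior : ℝ}
    (hτ : IsStoppingTime g.obsFiltration τ ∨
      (prior = 0 ∧ IsStoppingTime g.obsFiltrationWithZero τ)) :
    IsStoppingTime g.obsFiltrationWithZero τ := by
  rcases hτ with hτ | ⟨-, hτ⟩
  · exact fun k => (le_sup_left : g.obsFiltration k ≤ _) _ (hτ k)
  · exact hτ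

/-- On the support of the prior, the stopping time does not depend on the change-point. -/
lemma stoppingTime_eq {τ : Path → ℕ∞} {prior ρ : ℝ}
    (hτ : IsStoppingTime g.obsFiltration τ ∨
      (prior = 0 ∧ IsStoppingTime g.obsFiltrationWithZero τ))
    {l : ℕ} (hl : changeWeight prior ρ l ≠ 0) (z : (ℕ → ℝ) × (ℕ → ℕ)) :
    τ (l, z) = τ (1, z) := by
  refine enat_eq_of_forall_le_iff fun k => ?_
  rcases hτ with hτ | ⟨rfl, hτ⟩
  · exact g.mem_iff_of_measurableSet_obsFiltration (hτ k) fun i _ => g.obs_eq_obs_one i l z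
  · have hl0 : l ≠ 0 := by rintro rfl; simp [changeWeight] at hl
    exact g.mem_iff_of_measurableSet_obsFiltrationWithZero (hτ k) (by simp [changePoint, hl0])
      fun i _ => g.obs_eq_obs_one i l z

lemma measurableSet_stoppingTime_le {τ : Path → ℕ∞}
    (hτ : IsStoppingTime g.obsFiltrationWithZero τ) (k : ℕ) :
    MeasurableSet {z : (ℕ → ℝ) × (ℕ → ℕ) | τ (1, z) ≤ k} :=
  (g.obsFiltrationWithZero.le k _ (hτ k)).preimage (measurable_const.prodMk measurable_id)

/-- Fixing the change-point at `1` makes the extra event `{Λ = 0}` constant, so both filtrations are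
treated alike. -/
lemma obsInvariant_stoppingTime_le {τ : Path → ℕ∞}
    (hτ : IsStoppingTime g.obsFiltrationWithZero τ) (k : ℕ) :
    ObsInvariant g {z : (ℕ → ℝ) × (ℕ → ℕ) | τ (1, z) ≤ k} k := fun _ _ h =>
  g.mem_iff_of_measurableSet_obsFiltrationWithZero (hτ k) (by simp [changePoint]) h

lemma Strategy.rights_eq_rights_one (N C l : ℕ) (z : (ℕ → ℝ) × (ℕ → ℕ)) (k : ℕ) :
    g.rights N C (l, z) k = g.rights N C (1, z) k := by
  induction k with
  | zero => rfl
  | succ k ih =>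
    simp only [Strategy.rights, ih, g.decision_eq_sampled, arrivals]

end StoppingTimes

/-! ### Mixing over the change-point -/

section Prior

variable {prior ρ : ℝ} (f₀ f₁ : Pdf) (p : PMF ℕ)

lemma modelLaw_eq (prior ρ : ℝ) : modelLaw prior ρ f₀ f₁ p = Measure.sum fun l =>
    changeWeight prior ρ l • (conditionalLaw f₀ f₁ p l).map (Prod.mk l) := by
  simp only [modelLaw, Measure.dirac_prod]

lemma changeWeight_mul_le_modelLaw (prior ρ : ℝ) (l : ℕ) (s : Set Path) :
    changeWeight prior ρ l * conditionalLaw f₀ f₁ p l (Prod.mk l ⁻¹' s)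
      ≤ modelLaw prior ρ f₀ f₁ p s := by
  rw [modelLaw_eq]
  refine le_trans ?_ (Measure.le_sum_apply _ s)
  refine le_trans ?_ (ENNReal.le_tsum l)
  rw [Measure.smul_apply, (measurableEmbedding_prodMk_left l).map_apply, smul_eq_mul]

lemma sum_changeWeight_mul_le_lintegral (prior ρ : ℝ) (K : ℕ) (F : Path → ℝ≥0∞) :
    ∑ l ∈ Finset.range K, changeWeight prior ρ l * ∫⁻ z, F (l, z) ∂conditionalLaw f₀ f₁ p l
      ≤ ∫⁻ ω, F ω ∂modelLaw prior ρ f₀ f₁ p := by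
  rw [modelLaw_eq, lintegral_sum_measure]
  refine le_trans (le_of_eq (Finset.sum_congr rfl fun l _ => ?_)) (ENNReal.sum_le_tsum _)
  rw [lintegral_smul_measure, (measurableEmbedding_prodMk_left l).lintegral_map, smul_eq_mul]

lemma ae_conditionalLaw_of_ae_modelLaw {l : ℕ} (hl : changeWeight prior ρ l ≠ 0)
    {Q : Path → Prop} (h : ∀ᵐ ω ∂modelLaw prior ρ f₀ f₁ p, Q ω) :
    ∀ᵐ z ∂conditionalLaw f₀ f₁ p l, Q (l, z) := by
  have := le_antisymm ((changeWeight_mul_le_modelLaw f₀ f₁ p prior ρ l {ω | ¬ Q ω}).trans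
    (le_of_eq (ae_iff.1 h))) zero_le
  exact ae_iff.2 ((mul_eq_zero.1 this).resolve_left hl)

lemma changeWeight_succ_ne_zero (hprior : prior < 1) (hρ : 0 < ρ ∧ ρ < 1) (l : ℕ) :
    changeWeight prior ρ (l + 1) ≠ 0 := by
  have h1 : 0 < 1 - prior := by linarith
  have h2 : 0 < 1 - ρ := by linarith [hρ.2]
  have h3 := hρ.1
  simp only [changeWeight, ne_eq, ENNReal.ofReal_eq_zero, not_le]
  positivity

lemma sum_changeWeight (hprior : 0 ≤ prior ∧ prior < 1) (hρ : 0 < ρ ∧ ρ < 1) (K : ℕ) :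
    ∑ l ∈ Finset.range (K + 1), changeWeight prior ρ l
      = ENNReal.ofReal (1 - (1 - prior) * (1 - ρ) ^ K) := by
  have h1 : 0 < 1 - prior := by linarith [hprior.2]
  have h2 : 0 < 1 - ρ := by linarith [hρ.2]
  induction K with
  | zero => simp [changeWeight]
  | succ K ih =>
    have hK : (1 - ρ) ^ K ≤ 1 := pow_le_one₀ h2.le (by linarith [hρ.1])
    have hρ0 := hρ.1
    have hnn : 0 ≤ 1 - (1 - prior) * (1 - ρ) ^ K := by nlinarith [hprior.1]
    rw [Finset.sum_range_succ, ih, changeWeight, ← ENNReal.ofReal_add hnn (by positivity)]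
    congr 1
    ring

end Prior

/-! ### From rare false alarms to long delays -/

section Delay

variable {prior ρ : ℝ} (f₀ f₁ : Pdf) {p w : PMF ℕ} {C : ℕ}

/-- Events determined by the first `j + n` observations which are rare under a later change are
rare under a change at `j + 1`, when `n` is a fraction of the critical horizon. -/
lemma IsGreedyStationary.eventually_conditionalLaw_le (hw : IsGreedyStationary C p w)
    (hprior : 0 ≤ prior ∧ prior < 1) (hρ : 0 < ρ ∧ ρ < 1) (hac : f₁.law ≪ f₀.law)
    (hint : Integrable (llr f₁.law f₀.law) f₁.law)
    (hD : 0 ≤ ∫ y, llr f₁.law f₀.law y ∂f₁.law) (N j : ℕ) {d : ℝ}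
    (hd : d = greedySamplingProb p w * (∫ y, llr f₁.law f₀.law y ∂f₁.law) + -Real.log (1 - ρ))
    {ε : ℝ} (hε : 0 < ε) (hε1 : ε < 1) :
    ∀ᶠ α : ℝ in 𝓝[>] 0, ∀ (g : Strategy),
      (∀ᵐ z ∂conditionalLaw f₀ f₁ p (j + 1), ∀ k, 0 ≤ g.rights N C (1, z) k) →
      ∀ n : ℕ, n = ⌈(1 - ε / 2) * (-Real.log α) / d⌉₊ →
      ∀ A : Set ((ℕ → ℝ) × (ℕ → ℕ)), MeasurableSet A → ObsInvariant g A (j + n) →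
      changeWeight prior ρ (j + n + 1) * conditionalLaw f₀ f₁ p (j + n + 1) A
        ≤ ENNReal.ofReal α →
      conditionalLaw f₀ f₁ p (j + 1) A ≤ ENNReal.ofReal (ε / 4) := by
  set D := ∫ y, llr f₁.law f₀.law y ∂f₁.law
  set q := greedySamplingProb p w
  have hq0 : 0 ≤ q := (greedySamplingProb_mem_Icc p w).1
  have hprior1 : 0 < 1 - prior := by linarith [hprior.2]
  have hρ1 : 0 < 1 - ρ := by linarith [hρ.2]
  have hρ0 := hρ.1
  have hκ : 0 < -Real.log (1 - ρ) := by
    have := Real.log_neg hρ1 (by linarith); linarith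
  have hd0 : 0 < d := by rw [hd]; positivity
  have hx : Tendsto (fun α : ℝ => -Real.log α) (𝓝[>] 0) atTop :=
    tendsto_neg_atBot_atTop.comp Real.tendsto_log_nhdsGT_zero
  obtain ⟨n₀, hn₀⟩ := hw.exists_measure_llr_le f₀ f₁ hint hD N j
    (show 0 < d * (ε / 4) by positivity) (show 0 < ε / 8 by positivity)
  -- The inverse prior weight of a change at `j + 1`. It is fixed as `α` tends to `0`, since `j` is.
  set c := ((1 - prior) * ρ * (1 - ρ) ^ j)⁻¹ with hc
  have hlim : Tendsto (fun α : ℝ => c * Real.exp (2 * d + -(ε / 4) * (-Real.log α))) (𝓝[>] 0)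
      (𝓝 (c * 0)) := by
    refine Tendsto.const_mul c (Real.tendsto_exp_atBot.comp ?_)
    refine tendsto_atBot_add_const_left _ _ ?_
    exact hx.const_mul_atTop_of_neg (by linarith)
  rw [mul_zero] at hlim
  have hn : ∀ᶠ α : ℝ in 𝓝[>] 0, (n₀ : ℝ) ≤ (1 - ε / 2) * (-Real.log α) / d := by
    have : Tendsto (fun α : ℝ => (1 - ε / 2) * (-Real.log α) / d) (𝓝[>] 0) atTop :=
      (hx.const_mul_atTop (by linarith)).atTop_div_const hd0
    exact this.eventually_ge_atTop _
  filter_upwards [hn, hlim.eventually (ge_mem_nhds (show 0 < ε / 8 by positivity)),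
    hx.eventually_ge_atTop 0, self_mem_nhdsWithin]
    with α hα1 hα2 hα3 hα0 g hg n hnα A hA hAinv hpfa
  have hα0 : 0 < α := hα0
  set x := -Real.log α with hxdef
  have hnn : n₀ ≤ n := by
    rw [hnα]; exact_mod_cast hα1.trans (Nat.le_ceil _)
  have hnle : (n : ℝ) ≤ (1 - ε / 2) * x / d + 1 := by
    rw [hnα]
    refine (Nat.ceil_lt_add_one ?_).le
    have : 0 ≤ 1 - ε / 2 := by linarith
    positivity
  set a := (q * D + d * (ε / 4)) * n with ha
  have hW : 0 < (1 - prior) * ρ * (1 - ρ) ^ (j + n) := by positivity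
  have hlate : conditionalLaw f₀ f₁ p (j + n + 1) A
      ≤ ENNReal.ofReal (α / ((1 - prior) * ρ * (1 - ρ) ^ (j + n))) := by
    rw [ENNReal.ofReal_div_of_pos hW, ENNReal.le_div_iff_mul_le
      (Or.inl (by simpa using hW)) (Or.inl ENNReal.ofReal_ne_top), mul_comm]
    exact hpfa
  have hexp : Real.exp a * (α / ((1 - prior) * ρ * (1 - ρ) ^ (j + n))) ≤ ε / 8 := by
    refine le_trans ?_ hα2
    have h1 : α = Real.exp (-x) := by rw [hxdef, neg_neg, Real.exp_log hα0]
    have h2 : (1 - ρ) ^ n = Real.exp (-(-Real.log (1 - ρ)) * n) := by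
      rw [neg_neg, mul_comm, Real.exp_nat_mul, Real.exp_log hρ1]
    have h3 : Real.exp a * (α / ((1 - prior) * ρ * (1 - ρ) ^ (j + n)))
        = c * Real.exp (a + -x + -Real.log (1 - ρ) * n) := by
      rw [pow_add, h2, h1, hc, Real.exp_add, Real.exp_add, neg_mul, Real.exp_neg (_ * _)]
      field_simp
    rw [h3]
    refine mul_le_mul_of_nonneg_left (Real.exp_le_exp.2 ?_) (by positivity)
    -- Information and prior decay together cost `d` per slot plus slack. As `(1 + ε / 4) * (1 - ε /
    -- 2) ≤ 1 - ε / 4`, the exponent is at most `2 * d - (ε / 4) * x`; the `2 * d` covers the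
    -- rounding of `n`.
    have h4 : a + -Real.log (1 - ρ) * n = d * (1 + ε / 4) * n := by
      rw [ha, hd]; ring
    have h5 : d * (1 + ε / 4) * n ≤ d * (1 + ε / 4) * ((1 - ε / 2) * x / d + 1) := by gcongr
    have h6 : d * (1 + ε / 4) * ((1 - ε / 2) * x / d + 1)
        = (1 + ε / 4) * (1 - ε / 2) * x + d * (1 + ε / 4) := by
      field_simp
    have h7 : (1 + ε / 4) * (1 - ε / 2) * x ≤ (1 - ε / 4) * x :=
      mul_le_mul_of_nonneg_right (by nlinarith) hα3
    nlinarith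
  calc conditionalLaw f₀ f₁ p (j + 1) A
      ≤ ENNReal.ofReal (Real.exp a) * conditionalLaw f₀ f₁ p (j + n + 1) A
        + conditionalLaw f₀ f₁ p (j + 1) {z | a < sampledSum g (llr f₁.law f₀.law) j n z} :=
        conditionalLaw_le_exp_mul_add f₀ f₁ p g hac hA hAinv n j a
    _ ≤ ENNReal.ofReal (ε / 8) + ENNReal.ofReal (ε / 8) := by
        refine add_le_add ?_ (hn₀ n hnn g hg)
        calc _ ≤ ENNReal.ofReal (Real.exp a)
              * ENNReal.ofReal (α / ((1 - prior) * ρ * (1 - ρ) ^ (j + n))) := by gcongr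
          _ ≤ _ := by
            rw [← ENNReal.ofReal_mul (Real.exp_pos _).le]
            exact ENNReal.ofReal_le_ofReal hexp
    _ = ENNReal.ofReal (ε / 4) := by
        rw [← ENNReal.ofReal_add (by positivity) (by positivity)]
        congr 1; ring

/-- The delay bound up to a factor `1 - ε`, uniformly in the strategy and the stopping time. -/
lemma IsGreedyStationary.eventually_le_avgDelay (hw : IsGreedyStationary C p w)
    (hprior : 0 ≤ prior ∧ prior < 1) (hρ : 0 < ρ ∧ ρ < 1) (hac : f₁.law ≪ f₀.law)
    (hint : Integrable (llr f₁.law f₀.law) f₁.law)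
    (hD : 0 ≤ ∫ y, llr f₁.law f₀.law y ∂f₁.law) (N : ℕ) {d : ℝ}
    (hd : d = greedySamplingProb p w * (∫ y, llr f₁.law f₀.law y ∂f₁.law) + -Real.log (1 - ρ))
    {ε : ℝ} (hε : 0 < ε) (hε1 : ε < 1) :
    ∀ᶠ α : ℝ in 𝓝[>] 0, ∀ (g : Strategy) (τ : Path → ℕ∞),
      g.Admissible N C (modelLaw prior ρ f₀ f₁ p) →
      (IsStoppingTime g.obsFiltration τ ∨
        (prior = 0 ∧ IsStoppingTime g.obsFiltrationWithZero τ)) →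
      falseAlarm (modelLaw prior ρ f₀ f₁ p) τ ≤ ENNReal.ofReal α →
      ENNReal.ofReal (-Real.log α / d * (1 - ε)) ≤ avgDelay (modelLaw prior ρ f₀ f₁ p) τ := by
  have hprior1 : 0 < 1 - prior := by linarith [hprior.2]
  have hρ1 : 0 < 1 - ρ := by linarith [hρ.2]
  have hd0 : 0 < d := by
    have hq0 := (greedySamplingProb_mem_Icc p w).1
    have := Real.log_neg hρ1 (by linarith [hρ.1])
    rw [hd]; nlinarith
  have hx : Tendsto (fun α : ℝ => -Real.log α) (𝓝[>] 0) atTop :=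
    tendsto_neg_atBot_atTop.comp Real.tendsto_log_nhdsGT_zero
  -- The left side is the prior probability of a change after `K`; discarding those leaves finitely
  -- many `j`, over which the asymptotics are uniform.
  obtain ⟨K, hK⟩ : ∃ K : ℕ, (1 - prior) * (1 - ρ) ^ K ≤ ε / 4 := by
    obtain ⟨K, hK⟩ := exists_pow_lt_of_lt_one (show 0 < ε / 4 by positivity)
      (show 1 - ρ < 1 by linarith [hρ.1])
    refine ⟨K, le_trans ?_ hK.le⟩
    exact mul_le_of_le_one_left (by positivity) (by linarith [hprior.1])
  have hall := (eventually_all_finset (Finset.range (K + 1))).2 fun j _ =>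
    hw.eventually_conditionalLaw_le f₀ f₁ hprior hρ hac hint hD N j hd hε hε1
  filter_upwards [hall, hx.eventually_ge_atTop 0] with α hα hx0 g τ hadm hτ hpfa
  set n := ⌈(1 - ε / 2) * (-Real.log α) / d⌉₊ with hn
  have hτ0 := isStoppingTime_obsFiltrationWithZero g hτ
  have hterm : ∀ l ∈ Finset.range (K + 1), changeWeight prior ρ l
        * ENNReal.ofReal (n * (1 - ε / 4))
      ≤ changeWeight prior ρ l
        * ∫⁻ z, ((τ (l, z) - (l : ℕ∞) : ℕ∞) : ℝ≥0∞) ∂conditionalLaw f₀ f₁ p l := by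
    intro l hl
    rcases eq_or_ne (changeWeight prior ρ l) 0 with hl0 | hl0
    · simp [hl0]
    gcongr
    -- Changes at `0` and `1` give the same conditional law, so `l = 0` is treated with `j = 0`;
    -- only `l ≤ j + 1` is then needed for the delay.
    obtain ⟨j, hjK, hQ, hlj⟩ : ∃ j ∈ Finset.range (K + 1),
        conditionalLaw f₀ f₁ p l = conditionalLaw f₀ f₁ p (j + 1) ∧ l ≤ j + 1 := by
      cases l with
      | zero => exact ⟨0, hl, conditionalLaw_zero f₀ f₁ p, Nat.zero_le _⟩
      | succ j =>
        have := Finset.mem_range.1 hl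
        exact ⟨j, Finset.mem_range.2 (by lia), rfl, le_rfl⟩
    rw [hQ]
    have hadm' : ∀ᵐ z ∂conditionalLaw f₀ f₁ p (j + 1), ∀ k, 0 ≤ g.rights N C (1, z) k := by
      filter_upwards [ae_conditionalLaw_of_ae_modelLaw f₀ f₁ p
        (changeWeight_succ_ne_zero hprior.2 hρ j) hadm] with z hz k
      rw [← g.rights_eq_rights_one N C (j + 1)]
      exact hz k
    set A : Set ((ℕ → ℝ) × (ℕ → ℕ)) := {z | τ (1, z) ≤ ((j + n : ℕ) : ℕ∞)} with hA
    have hAm : MeasurableSet A := measurableSet_stoppingTime_le g hτ0 (j + n)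
    -- The stopping time cannot distinguish change-points of positive prior weight, so stopping by
    -- `j + n` is a false alarm when the change is at `j + n + 1`.
    have hsub : A ⊆ Prod.mk (j + n + 1) ⁻¹' {ω : Path | τ ω < (changePoint ω : ℕ∞)} := by
      intro z hz
      change τ (j + n + 1, z) < ((j + n + 1 : ℕ) : ℕ∞)
      rw [stoppingTime_eq g hτ (changeWeight_succ_ne_zero hprior.2 hρ (j + n))]
      exact lt_of_le_of_lt hz (by exact_mod_cast Nat.lt_succ_self _)
    have hAle := hα j hjK g hadm' n hn A hAm (obsInvariant_stoppingTime_le g hτ0 (j + n))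
      (le_trans (by gcongr) ((changeWeight_mul_le_modelLaw f₀ f₁ p prior ρ (j + n + 1) _).trans hpfa))
    have hcompl : ENNReal.ofReal (1 - ε / 4) ≤ conditionalLaw f₀ f₁ p (j + 1) Aᶜ := by
      rw [prob_compl_eq_one_sub hAm, ENNReal.ofReal_sub _ (by positivity), ENNReal.ofReal_one]
      exact tsub_le_tsub_left hAle 1
    calc ENNReal.ofReal (n * (1 - ε / 4))
        = n * ENNReal.ofReal (1 - ε / 4) := by
          rw [ENNReal.ofReal_mul (by positivity), ENNReal.ofReal_natCast]
      _ ≤ n * conditionalLaw f₀ f₁ p (j + 1) Aᶜ := by gcongr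
      _ = ∫⁻ _ in Aᶜ, (n : ℝ≥0∞) ∂conditionalLaw f₀ f₁ p (j + 1) := by
          rw [setLIntegral_const]
      _ ≤ ∫⁻ z in Aᶜ, ((τ (l, z) - (l : ℕ∞) : ℕ∞) : ℝ≥0∞) ∂conditionalLaw f₀ f₁ p (j + 1) := by
          refine setLIntegral_mono' hAm.compl fun z hz => ?_
          have hz' : ((j + n : ℕ) : ℕ∞) < τ (1, z) := not_le.1 hz
          rw [stoppingTime_eq g hτ hl0]
          have : ((n : ℕ∞)) ≤ τ (1, z) - (l : ℕ∞) := by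
            cases hτz : τ (1, z) with
            | top => simp
            | coe m =>
              rw [hτz] at hz'
              have hm : j + n < m := by exact_mod_cast hz'
              have : n ≤ m - l := by lia
              exact_mod_cast this
          exact_mod_cast this
      _ ≤ _ := setLIntegral_le_lintegral _ _
  -- Three losses multiply: discarded change-points, the shortened horizon, and the chance of early
  -- stopping. Their product is at least `1 - ε`.
  have hreal : -Real.log α / d * (1 - ε)
      ≤ (1 - (1 - prior) * (1 - ρ) ^ K) * (n * (1 - ε / 4)) := by
    have hnge : (1 - ε / 2) * (-Real.log α / d) ≤ n := by
      rw [← mul_div_assoc]; exact Nat.le_ceil _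
    have hy : 0 ≤ -Real.log α / d := by positivity
    calc -Real.log α / d * (1 - ε)
        ≤ -Real.log α / d * ((1 - ε / 4) * (1 - ε / 2) * (1 - ε / 4)) :=
          mul_le_mul_of_nonneg_left (by nlinarith [sq_nonneg ε]) hy
      _ = (1 - ε / 4) * ((1 - ε / 2) * (-Real.log α / d) * (1 - ε / 4)) := by ring
      _ ≤ (1 - ε / 4) * (n * (1 - ε / 4)) := by
          have : 0 ≤ 1 - ε / 4 := by linarith
          gcongr
      _ ≤ _ := by
          have : 0 ≤ 1 - ε / 4 := by linarith
          gcongr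
  calc ENNReal.ofReal (-Real.log α / d * (1 - ε))
      ≤ ENNReal.ofReal (1 - (1 - prior) * (1 - ρ) ^ K) * ENNReal.ofReal (n * (1 - ε / 4)) := by
        rw [← ENNReal.ofReal_mul (by linarith)]
        exact ENNReal.ofReal_le_ofReal hreal
    _ = ∑ l ∈ Finset.range (K + 1), changeWeight prior ρ l * ENNReal.ofReal (n * (1 - ε / 4)) := by
        rw [← sum_changeWeight hprior hρ, Finset.sum_mul]
    _ ≤ _ := Finset.sum_le_sum hterm
    _ ≤ avgDelay (modelLaw prior ρ f₀ f₁ p) τ :=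
        sum_changeWeight_mul_le_lintegral f₀ f₁ p prior ρ (K + 1)
          fun ω => ((τ ω - (changePoint ω : ℕ∞) : ℕ∞) : ℝ≥0∞)

/-- Bounds that hold eventually up to each factor `1 - ε` hold up to a factor `1 + o(1)`. -/
lemma exists_tendsto_zero_of_eventually {Q : ℝ → ℝ → Prop}
    (hmono : ∀ α ε ε', ε ≤ ε' → 0 < α → α < 1 → Q ε α → Q ε' α)
    (hone : ∀ α, 0 < α → α < 1 → Q 1 α)
    (hev : ∀ ε, 0 < ε → ε < 1 → ∀ᶠ α in 𝓝[>] (0 : ℝ), Q ε α) :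
    ∃ o : ℝ → ℝ, Tendsto o (𝓝[>] 0) (𝓝 0) ∧ ∀ α, 0 < α → α < 1 → Q (-o α) α := by
  set S : ℝ → Set ℝ := fun α => {ε | 0 ≤ ε ∧ Q ε α} with hS
  have hbdd : ∀ α, BddBelow (S α) := fun α => ⟨0, fun _ h => h.1⟩
  -- The infimum need not be attained; the added `α` exceeds it strictly and still tends to `0`.
  refine ⟨fun α => -(sInf (S α) + α), ?_, fun α hα hα1 => ?_⟩
  · have hinf : Tendsto (fun α => sInf (S α)) (𝓝[>] 0) (𝓝 0) := by
      rw [Metric.tendsto_nhds]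
      intro ε hε
      have hε' : 0 < min (ε / 2) (1 / 2) := by positivity
      filter_upwards [hev _ hε' (lt_of_le_of_lt (min_le_right _ _) (by norm_num))] with α hα
      have h1 : sInf (S α) ≤ min (ε / 2) (1 / 2) := csInf_le (hbdd α) ⟨hε'.le, hα⟩
      have h0 : 0 ≤ sInf (S α) := Real.sInf_nonneg fun _ h => h.1
      rw [Real.dist_eq, sub_zero, abs_of_nonneg h0]
      exact lt_of_le_of_lt (h1.trans (min_le_left _ _)) (by linarith)
    have hid : Tendsto (fun α : ℝ => α) (𝓝[>] 0) (𝓝 0) := tendsto_nhdsWithin_of_tendsto_nhds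
      tendsto_id
    simpa using (hinf.add hid).neg
  · have hne : (S α).Nonempty := ⟨1, zero_le_one, hone α hα hα1⟩
    obtain ⟨ε, hε, hlt⟩ := exists_lt_of_csInf_lt hne (show sInf (S α) < sInf (S α) + α by linarith)
    rw [neg_neg]
    exact hmono α ε _ hlt.le hα hα1 hε.2

end Delay

end SamplingRights

theorem theorem5
    (prior ρ : ℝ) (hprior : 0 ≤ prior ∧ prior < 1) (hρ : 0 < ρ ∧ ρ < 1)
    (f₀ f₁ : SamplingRights.Pdf)
    (hD : InformationTheory.klDiv f₁.law f₀.law ≠ ∞)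
    (p : PMF ℕ) (N C : ℕ)
    (w : PMF ℕ) (hw : SamplingRights.IsGreedyStationary C p w) :
    ∃ o : ℝ → ℝ, Tendsto o (𝓝[>] 0) (𝓝 0) ∧
      ∀ α : ℝ, 0 < α → α < 1 →
      ∀ (g : SamplingRights.Strategy) (τ : SamplingRights.Path → ℕ∞),
        g.Admissible N C (SamplingRights.modelLaw prior ρ f₀ f₁ p) →
        (IsStoppingTime g.obsFiltration τ ∨
          (prior = 0 ∧ IsStoppingTime g.obsFiltrationWithZero τ)) →
        SamplingRights.falseAlarm (SamplingRights.modelLaw prior ρ f₀ f₁ p) τ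
          ≤ ENNReal.ofReal α →
        ENNReal.ofReal
            (|Real.log α| /
                (SamplingRights.greedySamplingProb p w *
                    (InformationTheory.klDiv f₁.law f₀.law).toReal
                  + |Real.log (1 - ρ)|) * (1 + o α))
          ≤ SamplingRights.avgDelay (SamplingRights.modelLaw prior ρ f₀ f₁ p) τ := by
  obtain ⟨hac, hint⟩ := InformationTheory.klDiv_ne_top_iff.1 hD
  have hkl : (InformationTheory.klDiv f₁.law f₀.law).toReal
      = ∫ y, llr f₁.law f₀.law y ∂f₁.law :=
    InformationTheory.toReal_klDiv_of_measure_eq hac (by simp)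
  have hD0 : 0 ≤ ∫ y, llr f₁.law f₀.law y ∂f₁.law := hkl ▸ ENNReal.toReal_nonneg
  have hlogρ : |Real.log (1 - ρ)| = -Real.log (1 - ρ) :=
    abs_of_neg (Real.log_neg (by linarith [hρ.2]) (by linarith [hρ.1]))
  rw [hkl, hlogρ]
  set d := SamplingRights.greedySamplingProb p w * (∫ y, llr f₁.law f₀.law y ∂f₁.law)
    + -Real.log (1 - ρ) with hd
  have hd0 : 0 ≤ d := by
    have := (SamplingRights.greedySamplingProb_mem_Icc p w).1
    have : 0 ≤ -Real.log (1 - ρ) := hlogρ ▸ abs_nonneg _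
    positivity
  have hlog : ∀ α : ℝ, 0 < α → α < 1 → |Real.log α| = -Real.log α := fun α h0 h1 =>
    abs_of_neg (Real.log_neg h0 h1)
  -- The quantifiers over strategies and stopping times are inside `Q`, so the resulting `o` is
  -- uniform in both. At `ε = 1` the bound is trivial.
  obtain ⟨o, ho, hbound⟩ := SamplingRights.exists_tendsto_zero_of_eventually
    (Q := fun ε α => ∀ (g : SamplingRights.Strategy) (τ : SamplingRights.Path → ℕ∞),
      g.Admissible N C (SamplingRights.modelLaw prior ρ f₀ f₁ p) →
      (IsStoppingTime g.obsFiltration τ ∨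
        (prior = 0 ∧ IsStoppingTime g.obsFiltrationWithZero τ)) →
      SamplingRights.falseAlarm (SamplingRights.modelLaw prior ρ f₀ f₁ p) τ ≤ ENNReal.ofReal α →
      ENNReal.ofReal (-Real.log α / d * (1 - ε))
        ≤ SamplingRights.avgDelay (SamplingRights.modelLaw prior ρ f₀ f₁ p) τ)
    (fun α ε ε' hε h0 h1 H g τ ha hτ hf => by
      refine le_trans (ENNReal.ofReal_le_ofReal ?_) (H g τ ha hτ hf)
      have : 0 ≤ -Real.log α := by linarith [Real.log_neg h0 h1]
      gcongr)
    (fun α _ _ g τ _ _ _ => by simp)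
    (fun ε hε hε1 => hw.eventually_le_avgDelay f₀ f₁ hprior hρ hac hint hD0 N hd hε hε1)
  refine ⟨o, ho, fun α h0 h1 g τ ha hτ hf => ?_⟩
  have := hbound α h0 h1 g τ ha hτ hf
  rwa [sub_neg_eq_add, ← hlog α h0 h1] at this
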